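/- **Theorem 4.4.** Let $a:\mathbb R\to(0,\infty)$ be continuous and $b:\mathbb R\to\mathbb R$ be such that $b/a$ is locally integrable. Put $C(x)=\int_0^x b/a$ and assume $Z=\int_{\mathbb R}e^{C}/a<\infty$. Let $L=a\,\frac{d^2}{dx^2}+b\,\frac{d}{dx}$, let $\mu(dx)=(Za(x))^{-1}e^{C(x)}dx$, $D(f)=\int_{\mathbb R}a f'^2\,d\mu\in[0,\infty]$, and $$\lambda_1(L)=\inf\{D(f): f\in C^1(\mathbb R),\ \mu(f)=0,\ \mu(f^2)=1\}.$$ For $\theta\in\mathbb R$ let $\mathbb R_\theta^+=(\theta,\infty)$, $\mathbb R_\theta^-=(-\infty,\theta)$, with closures $\overline{\mathbb R}{}_\theta^{\pm}$, and set $$\lambda_0^\pm(\theta)=\inf\{D(f): f|_{\mathbb R\setminus\mathbb R_\theta^\pm}=0,\ f\in C(\overline{\mathbb R}{}_\theta^{\pm})\cap C^1(\mathbb R_\theta^\pm),\ \mu(f^2)=1\},$$ $$\varphi_\theta(x)=\int_\theta^x e^{-C},\qquad \delta_\theta^\pm=\sup_{x\in\mathbb R_\theta^\pm}\varphi_\theta(x)\int_x^{\pm\infty}\frac{e^C}{a}\in(0,\infty],$$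 $$\mathcal F_{I\theta}^\pm=\{f\in C(\overline{\mathbb R}{}_\theta^{\pm})\cap C^1(\mathbb R_\theta^\pm): f(\theta)=0,\ f'>0\text{ on }\mathbb R_\theta^\pm\},$$ $$\mathcal F_{II\theta}^\pm=\{f\in C(\overline{\mathbb R}{}_\theta^{\pm}): f(\theta)=0,\ \pm f>0\text{ on }\mathbb R_\theta^\pm\},$$ $$I_\theta^\pm(f)(x)=\frac{e^{-C(x)}}{f'(x)}\int_x^{\pm\infty}\frac{fe^C}{a}\quad(f\in\mathcal F_{I\theta}^\pm),\qquad II_\theta^\pm(f)(x)=\frac1{f(x)}\int_\theta^x e^{-C(y)}\Big(\int_y^{\pm\infty}\frac{fe^C}{a}\Big)dy\quad(f\in\mathcal F_{II\theta}^\pm),$$ where $I_\theta^\pm(f)(x)$ and $II_\theta^\pm(f)(x)$ take values in $(0,\infty]$, and $1/\infty=0$. Then: 1. $\displaystyle\inf_{\theta\in\mathbb R}\big[\lambda_0^+(\theta)\vee\lambda_0^-(\theta)\big]\ \ge\ \lambda_1(L)\ \ge\ \sup_{\theta\in\mathbb R}\big[\lambda_0^+(\theta)\wedge\lambda_0^-(\theta)\big]$.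 Moreover, the limits of $\lambda_0^\pm(\theta)$ as $\theta\to\infty$ and as $\theta\to-\infty$ exist in $[0,\infty]$; extending $\lambda_0^\pm$ to $[-\infty,\infty]$ by these limits, the equation $\lambda_0^+(\theta)=\lambda_0^-(\theta)$ has a solution $\bar\theta\in[-\infty,\infty]$, and $\lambda_1(L)=\lambda_0^+(\bar\theta)$ for every such solution. 2. If $m$ is the median of $\mu$, then $2\big[\lambda_0^+(m)\wedge\lambda_0^-(m)\big]\ge\lambda_1(L)\ge\lambda_0^+(m)\wedge\lambda_0^-(m)$. 3. For every $\theta\in\mathbb R$ and either sign, $$\lambda_0^\pm(\theta)\ \ge\ \sup_{f\in\mathcal F_{II\theta}^\pm}\ \inf_{x\in\mathbb R_\theta^\pm}II_\theta^\pm(f)(x)^{-1}\ \ge\ \sup_{f\in\mathcal F_{I\theta}^\pm}\ \inf_{x\in\mathbb R_\theta^\pm}I_\theta^\pm(f)(x)^{-1},$$ and both inequalities are equalities if, in addition, $b$ is continuous. 4. For every $\theta\in\mathbb R$ and either sign, $(\delta_\theta^\pm)^{-1}\ge\lambda_0^\pm(\theta)\ge(4\delta_\theta^\pm)^{-1}$.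 -/

import Mathlib

open MeasureTheory Set Filter Topology
open scoped ENNReal

noncomputable section

namespace OneDimDiffusion

/-- The function `C(x) = ∫₀ˣ b/a`. -/
def potential (a b : ℝ → ℝ) (x : ℝ) : ℝ := ∫ t in (0 : ℝ)..x, b t / a t

/-- The density `e^C / a` of the speed measure with respect to Lebesgue measure. -/
def speedDensity (a b : ℝ → ℝ) (x : ℝ) : ℝ := Real.exp (potential a b x) / a x

/-- The normalizing constant `Z = ∫ e^C / a`. -/
def normConst (a b : ℝ → ℝ) : ℝ := ∫ x, speedDensity a b x

/-- The measure `μ(dx) = (Z a(x))⁻¹ e^{C(x)} dx`. -/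
def invMeasure (a b : ℝ → ℝ) : Measure ℝ :=
  volume.withDensity fun x => ENNReal.ofReal ((normConst a b)⁻¹ * speedDensity a b x)

/-- Standing assumptions on the operator `L = a d²/dx² + b d/dx`: `a` is continuous and positive,
`b/a` is locally integrable (so that `C` is defined) and `Z < ∞`. -/
structure Admissible (a b : ℝ → ℝ) : Prop where
  continuous_a : Continuous a
  a_pos : ∀ x, 0 < a x
  locallyIntegrable : LocallyIntegrable (fun x => b x / a x) volume
  integrable : Integrable (speedDensity a b) volume

/-- The form `D(f) = ∫ a f'² dμ`, with values in `[0, ∞]`. -/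
def energy (a b : ℝ → ℝ) (f : ℝ → ℝ) : ℝ≥0∞ :=
  ∫⁻ x, ENNReal.ofReal (a x * deriv f x ^ 2) ∂(invMeasure a b)

/-- `λ₁(L) = inf {D(f) : f ∈ C¹(ℝ), μ(f) = 0, μ(f²) = 1}`. -/
def lambdaOne (a b : ℝ → ℝ) : ℝ≥0∞ :=
  sInf {r | ∃ f : ℝ → ℝ, ContDiff ℝ 1 f ∧ ∫ x, f x ∂(invMeasure a b) = 0 ∧
    ∫ x, f x ^ 2 ∂(invMeasure a b) = 1 ∧ r = energy a b f}

/-- The two signs `±`. -/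
inductive Side
  | plus
  | minus

/-- The open half-lines `(θ, ∞)` and `(-∞, θ)`. -/
def ray : Side → ℝ → Set ℝ
  | .plus, θ => Ioi θ
  | .minus, θ => Iio θ

/-- The closed half-lines `[θ, ∞)` and `(-∞, θ]`. -/
def closedRay : Side → ℝ → Set ℝ
  | .plus, θ => Ici θ
  | .minus, θ => Iic θ

/-- `λ₀^±(θ)`: the infimum of `D(f)` over `f` vanishing off the open half-line, continuous on the
closed and `C¹` on the open half-line, with `μ(f²) = 1`. -/
def lambdaZero (a b : ℝ → ℝ) (s : Side) (θ : ℝ) : ℝ≥0∞ :=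
  sInf {r | ∃ f : ℝ → ℝ, (∀ x ∉ ray s θ, f x = 0) ∧ ContinuousOn f (closedRay s θ) ∧
    ContDiffOn ℝ 1 f (ray s θ) ∧ ∫ x, f x ^ 2 ∂(invMeasure a b) = 1 ∧ r = energy a b f}

/-- `λ₀^±` on `[-∞, ∞]`: at `±∞` the limit of `λ₀^±(θ)` (the lower limit, so that the value makes
sense before the limit is known to exist). -/
def lambdaZeroExt (a b : ℝ → ℝ) (s : Side) (θ : EReal) : ℝ≥0∞ :=
  if θ = ⊤ then liminf (lambdaZero a b s) atTop
  else if θ = ⊥ then liminf (lambdaZero a b s) atBot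
  else lambdaZero a b s θ.toReal

/-- `δ_θ^±`, the supremum over `x` in the open half-line of `|∫_θ^x e^{-C}|` times
`|∫_x^{±∞} e^C/a|` (both integrals are positive for `+` and negative for `-`). -/
def hardyDelta (a b : ℝ → ℝ) (s : Side) (θ : ℝ) : ℝ≥0∞ :=
  ⨆ x ∈ ray s θ, (∫⁻ y in uIoc θ x, ENNReal.ofReal (Real.exp (-potential a b y))) *
    ∫⁻ y in ray s x, ENNReal.ofReal (speedDensity a b y)

/-- The class `F_I^±` of test functions: `f(θ) = 0` and `f' > 0` on the open half-line. -/
def classI (s : Side) (θ : ℝ) : Set (ℝ → ℝ) :=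
  {f | ContinuousOn f (closedRay s θ) ∧ ContDiffOn ℝ 1 f (ray s θ) ∧ f θ = 0 ∧
    ∀ x ∈ ray s θ, 0 < deriv f x}

/-- The class `F_II^±` of test functions: `f(θ) = 0` and `±f > 0` on the open half-line. -/
def classII : Side → ℝ → Set (ℝ → ℝ)
  | .plus, θ => {f | ContinuousOn f (Ici θ) ∧ f θ = 0 ∧ ∀ x ∈ Ioi θ, 0 < f x}
  | .minus, θ => {f | ContinuousOn f (Iic θ) ∧ f θ = 0 ∧ ∀ x ∈ Iio θ, 0 < -f x}

/-- The positive quantity `|∫_x^{±∞} f e^C / a|`, in `[0, ∞]`, for `f` of constant sign. -/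
def tailIntegral (a b : ℝ → ℝ) (s : Side) (f : ℝ → ℝ) (x : ℝ) : ℝ≥0∞ :=
  ∫⁻ y in ray s x, ENNReal.ofReal (|f y| * speedDensity a b y)

/-- `I^±(f)(x) = (e^{-C(x)} / f'(x)) ∫_x^{±∞} f e^C / a`. For `f` in `F_I^±` the factor `f'` is
positive and the integral is nonnegative for either sign. -/
def opI (a b : ℝ → ℝ) (s : Side) (f : ℝ → ℝ) (x : ℝ) : ℝ≥0∞ :=
  ENNReal.ofReal (Real.exp (-potential a b x) / deriv f x) * tailIntegral a b s f x

/-- `II^±(f)(x) = (1 / f(x)) ∫_θ^x e^{-C(y)} dy ∫_y^{±∞} f e^C / a`. For `f` in `F_II^±` the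
iterated integral has the sign of `f`, so both may be replaced by their absolute values. -/
def opII (a b : ℝ → ℝ) (s : Side) (θ : ℝ) (f : ℝ → ℝ) (x : ℝ) : ℝ≥0∞ :=
  (∫⁻ y in uIoc θ x, ENNReal.ofReal (Real.exp (-potential a b y)) * tailIntegral a b s f y) /
    ENNReal.ofReal |f x|

/-- `sup_{f ∈ F_I^±} inf_x I^±(f)(x)⁻¹`. -/
def varI (a b : ℝ → ℝ) (s : Side) (θ : ℝ) : ℝ≥0∞ :=
  ⨆ f ∈ classI s θ, ⨅ x ∈ ray s θ, (opI a b s f x)⁻¹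

/-- `sup_{f ∈ F_II^±} inf_x II^±(f)(x)⁻¹`. -/
def varII (a b : ℝ → ℝ) (s : Side) (θ : ℝ) : ℝ≥0∞ :=
  ⨆ f ∈ classII s θ, ⨅ x ∈ ray s θ, (opII a b s θ f x)⁻¹

/-- `m` is a median of `μ`. -/
def IsMedian (μ : Measure ℝ) (m : ℝ) : Prop :=
  1 / 2 ≤ μ (Iic m) ∧ 1 / 2 ≤ μ (Ici m)

end OneDimDiffusion

end

namespace OneDimDiffusion

section Basic

variable {a b : ℝ → ℝ}

theorem Admissible.continuous_potential (h : Admissible a b) : Continuous (potential a b) := by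
  refine intervalIntegral.continuous_primitive (fun x y => ?_) 0
  rw [intervalIntegrable_iff]
  exact (h.locallyIntegrable.integrableOn_isCompact isCompact_uIcc).mono_set uIoc_subset_uIcc

theorem Admissible.continuous_speedDensity (h : Admissible a b) :
    Continuous (speedDensity a b) :=
  (Real.continuous_exp.comp h.continuous_potential).div h.continuous_a fun x => (h.a_pos x).ne'

theorem Admissible.continuous_scale (h : Admissible a b) :
    Continuous fun x => Real.exp (-potential a b x) :=
  Real.continuous_exp.comp h.continuous_potential.neg

theorem Admissible.speedDensity_pos (h : Admissible a b) (x : ℝ) : 0 < speedDensity a b x :=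
  div_pos (Real.exp_pos _) (h.a_pos x)

theorem Admissible.normConst_pos (h : Admissible a b) : 0 < normConst a b := by
  rw [normConst, integral_pos_iff_support_of_nonneg (fun x => (h.speedDensity_pos x).le)
    h.integrable]
  have : Function.support (speedDensity a b) = univ :=
    eq_univ_of_forall fun x => (h.speedDensity_pos x).ne'
  simp [this]

theorem Admissible.setLIntegral_invMeasure (h : Admissible a b) (g : ℝ → ℝ≥0∞) {s : Set ℝ}
    (hs : MeasurableSet s) :
    ∫⁻ x in s, g x ∂(invMeasure a b) =
      ENNReal.ofReal (normConst a b)⁻¹ *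
        ∫⁻ x in s, ENNReal.ofReal (speedDensity a b x) * g x := by
  have hm : Measurable fun x => ENNReal.ofReal ((normConst a b)⁻¹ * speedDensity a b x) :=
    (measurable_const.mul h.continuous_speedDensity.measurable).ennreal_ofReal
  rw [invMeasure, setLIntegral_withDensity_eq_setLIntegral_mul_non_measurable _ hm _ hs
    (by simp), ← lintegral_const_mul' _ _ ENNReal.ofReal_ne_top]
  refine lintegral_congr fun x => ?_
  rw [Pi.mul_apply, ENNReal.ofReal_mul (inv_nonneg.2 h.normConst_pos.le), mul_assoc]

theorem Admissible.lintegral_speedDensity (h : Admissible a b) :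
    ∫⁻ x, ENNReal.ofReal (speedDensity a b x) = ENNReal.ofReal (normConst a b) := by
  rw [normConst, ofReal_integral_eq_lintegral_ofReal h.integrable
    (ae_of_all _ fun x => (h.speedDensity_pos x).le)]

theorem Admissible.isProbabilityMeasure (h : Admissible a b) :
    IsProbabilityMeasure (invMeasure a b) := by
  constructor
  have := h.setLIntegral_invMeasure (fun _ => 1) MeasurableSet.univ
  simp only [Measure.restrict_univ, lintegral_const, one_mul, mul_one,
    h.lintegral_speedDensity] at this
  rw [this, ← ENNReal.ofReal_mul (inv_nonneg.2 h.normConst_pos.le),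
    inv_mul_cancel₀ h.normConst_pos.ne', ENNReal.ofReal_one]

theorem invMeasure_singleton (a b : ℝ → ℝ) (x : ℝ) : invMeasure a b {x} = 0 :=
  withDensity_absolutelyContinuous _ _ (by simp)

theorem isOpen_ray (s : Side) (θ : ℝ) : IsOpen (ray s θ) := by
  cases s
  exacts [isOpen_Ioi, isOpen_Iio]

theorem isClosed_closedRay (s : Side) (θ : ℝ) : IsClosed (closedRay s θ) := by
  cases s
  exacts [isClosed_Ici, isClosed_Iic]

theorem measurableSet_ray (s : Side) (θ : ℝ) : MeasurableSet (ray s θ) :=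
  (isOpen_ray s θ).measurableSet

theorem notMem_ray_self (s : Side) (θ : ℝ) : θ ∉ ray s θ := by
  cases s <;> simp [ray]

theorem ray_subset_closedRay (s : Side) (θ : ℝ) : ray s θ ⊆ closedRay s θ := by
  cases s
  exacts [Ioi_subset_Ici_self, Iio_subset_Iic_self]

theorem mem_closedRay_iff {s : Side} {θ x : ℝ} : x ∈ closedRay s θ ↔ x = θ ∨ x ∈ ray s θ := by
  cases s
  · exact (le_iff_eq_or_lt (a := θ) (b := x)).trans (or_congr_left eq_comm)
  · exact le_iff_eq_or_lt (a := x) (b := θ)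

theorem closedRay_subset_ray {s : Side} {θ θ' : ℝ} (h : θ' ∈ ray s θ) :
    closedRay s θ' ⊆ ray s θ := by
  cases s
  · exact fun x (hx : θ' ≤ x) => lt_of_lt_of_le (show θ < θ' from h) hx
  · exact fun x (hx : x ≤ θ') => lt_of_le_of_lt hx (show θ' < θ from h)

end Basic

section Truncation

/-- The derivative of the truncation `truncate n`: a continuous cutoff with values in `[0, 1]`,
vanishing for `|s| ≤ 1 / n` and for `|s| ≥ n`, and tending to `1` off `0`. -/
noncomputable def truncateDeriv (n : ℕ) (s : ℝ) : ℝ :=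
  max 0 (min 1 (min (n * |s| - 1) (n - |s|)))

/-- A bounded `C¹` contraction vanishing near `0` that approximates the identity. -/
noncomputable def truncate (n : ℕ) (t : ℝ) : ℝ := ∫ s in (0 : ℝ)..t, truncateDeriv n s

theorem continuous_truncateDeriv (n : ℕ) : Continuous (truncateDeriv n) := by
  unfold truncateDeriv; fun_prop

theorem truncateDeriv_nonneg (n : ℕ) (s : ℝ) : 0 ≤ truncateDeriv n s := le_max_left _ _

theorem truncateDeriv_le_one (n : ℕ) (s : ℝ) : truncateDeriv n s ≤ 1 :=
  max_le zero_le_one (min_le_left _ _)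

theorem hasDerivAt_truncate (n : ℕ) (t : ℝ) :
    HasDerivAt (truncate n) (truncateDeriv n t) t :=
  (continuous_truncateDeriv n).integral_hasStrictDerivAt 0 t |>.hasDerivAt

theorem contDiff_truncate (n : ℕ) : ContDiff ℝ 1 (truncate n) := by
  rw [contDiff_one_iff_deriv]
  refine ⟨fun t => (hasDerivAt_truncate n t).differentiableAt, ?_⟩
  rw [show deriv (truncate n) = truncateDeriv n from
    funext fun t => (hasDerivAt_truncate n t).deriv]
  exact continuous_truncateDeriv n

theorem truncate_eq_zero (n : ℕ) {t : ℝ} (ht : n * |t| ≤ 1) : truncate n t = 0 := by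
  refine intervalIntegral.integral_zero_ae (ae_of_all _ fun s hs => ?_)
  have hst : |s| ≤ |t| := by
    rcases le_total 0 t with h | h
    · rw [uIoc_of_le h] at hs
      rw [abs_of_pos hs.1, abs_of_nonneg h]; exact hs.2
    · rw [uIoc_of_ge h] at hs
      rw [abs_of_nonpos hs.2, abs_of_nonpos h]; linarith [hs.1]
  refine max_eq_left ((min_le_right _ _).trans ((min_le_left _ _).trans ?_))
  have := mul_le_mul_of_nonneg_left hst (Nat.cast_nonneg (α := ℝ) n)
  linarith

theorem exists_abs_truncate_le (n : ℕ) : ∃ M, ∀ t, |truncate n t| ≤ M := by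
  have hsupp : HasCompactSupport (truncateDeriv n) := by
    refine HasCompactSupport.intro (isCompact_Icc (a := -(n : ℝ)) (b := n)) fun s hs => ?_
    refine max_eq_left ((min_le_right _ _).trans ((min_le_right _ _).trans ?_))
    by_contra! hlt
    exact hs (abs_le.1 (by linarith))
  have hint : Integrable (truncateDeriv n) :=
    (continuous_truncateDeriv n).integrable_of_hasCompactSupport hsupp
  refine ⟨∫ s, ‖truncateDeriv n s‖, fun t => ?_⟩
  exact intervalIntegral.norm_integral_le_integral_norm_uIoc.trans
    (setIntegral_le_integral hint.norm (ae_of_all _ fun s => norm_nonneg _))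

theorem tendsto_truncateDeriv {s : ℝ} (hs : s ≠ 0) :
    Tendsto (fun n => truncateDeriv n s) atTop (𝓝 1) := by
  have hs' : 0 < |s| := abs_pos.2 hs
  have h1 : ∀ᶠ n : ℕ in atTop, 2 ≤ (n : ℝ) * |s| :=
    (tendsto_natCast_atTop_atTop.atTop_mul_const hs').eventually_ge_atTop 2
  have h2 : ∀ᶠ n : ℕ in atTop, |s| + 1 ≤ (n : ℝ) :=
    tendsto_natCast_atTop_atTop.eventually_ge_atTop _
  refine tendsto_const_nhds.congr' ?_
  filter_upwards [h1, h2] with n hn1 hn2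
  rw [truncateDeriv, min_eq_left (le_min (by linarith) (by linarith)), max_eq_right zero_le_one]

theorem tendsto_truncate (t : ℝ) : Tendsto (fun n => truncate n t) atTop (𝓝 t) := by
  have : Tendsto (fun n => truncate n t) atTop (𝓝 (∫ _ in (0 : ℝ)..t, (1 : ℝ))) := by
    refine intervalIntegral.tendsto_integral_filter_of_dominated_convergence (fun _ => 1)
      (.of_forall fun n => (continuous_truncateDeriv n).aestronglyMeasurable)
      (.of_forall fun n => ae_of_all _ fun s _ => ?_) intervalIntegrable_const ?_
    · rw [Real.norm_of_nonneg (truncateDeriv_nonneg n s)]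
      exact truncateDeriv_le_one n s
    · have h0 : ∀ᵐ s : ℝ, s ≠ 0 := by simp [ae_iff]
      filter_upwards [h0] with s hs _ using tendsto_truncateDeriv hs
  simpa using this

end Truncation

section TestFunctions

variable {a b : ℝ → ℝ} {s : Side} {θ : ℝ}

/-- Bounded `C¹` functions on the line that vanish off a half-line strictly inside `ray s θ`. -/
structure IsTestFun (s : Side) (θ : ℝ) (g : ℝ → ℝ) : Prop where
  contDiff : ContDiff ℝ 1 g
  bounded : ∃ M, ∀ x, |g x| ≤ M
  eq_zero : ∃ θ' ∈ ray s θ, ∀ x ∉ ray s θ', g x = 0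

/-- Functions on the closed half-line that vanish at the end point, are continuous there and `C¹`
in the interior. -/
structure IsHalfLineFun (s : Side) (θ : ℝ) (g : ℝ → ℝ) : Prop where
  continuousOn : ContinuousOn g (closedRay s θ)
  contDiffOn : ContDiffOn ℝ 1 g (ray s θ)
  eq_zero : g θ = 0

theorem exists_mem_ray_dist_lt (s : Side) (θ : ℝ) {ε : ℝ} (hε : 0 < ε) :
    ∃ θ' ∈ ray s θ, ∀ x ∈ closedRay s θ, x ∉ ray s θ' → dist x θ < ε := by
  cases s
  · refine ⟨θ + ε / 2, by simp [ray, hε], fun x hx hx' => ?_⟩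
    simp only [closedRay, mem_Ici, ray, mem_Ioi, not_lt] at hx hx'
    rw [Real.dist_eq, abs_lt]; constructor <;> linarith
  · refine ⟨θ - ε / 2, by simp [ray, hε], fun x hx hx' => ?_⟩
    simp only [closedRay, mem_Iic, ray, mem_Iio, not_lt] at hx hx'
    rw [Real.dist_eq, abs_lt]; constructor <;> linarith

theorem IsHalfLineFun.hasDerivAt {g : ℝ → ℝ} (hg : IsHalfLineFun s θ g) {x : ℝ}
    (hx : x ∈ ray s θ) : HasDerivAt g (deriv g x) x :=
  ((hg.contDiffOn.differentiableOn one_ne_zero).differentiableAt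
    ((isOpen_ray s θ).mem_nhds hx)).hasDerivAt

theorem IsHalfLineFun.isTestFun_truncate {g : ℝ → ℝ} (hg : IsHalfLineFun s θ g) (n : ℕ) :
    IsTestFun s θ ((ray s θ).indicator fun x => truncate n (g x)) := by
  have hev : ∀ᶠ x in 𝓝[closedRay s θ] θ, (n : ℝ) * |g x| < 1 := by
    have hc := hg.continuousOn θ (mem_closedRay_iff.2 (Or.inl rfl))
    have : Tendsto (fun x => (n : ℝ) * |g x|) (𝓝[closedRay s θ] θ) (𝓝 (n * |g θ|)) :=
      (hc.abs).const_mul _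
    rw [hg.eq_zero, abs_zero, mul_zero] at this
    exact this.eventually_lt_const one_pos
  obtain ⟨ε, hε, hball⟩ := Metric.mem_nhdsWithin_iff.1 hev
  obtain ⟨θ', hθ', hdist⟩ := exists_mem_ray_dist_lt s θ hε
  have hzero : ∀ x ∉ ray s θ', (ray s θ).indicator (fun x => truncate n (g x)) x = 0 := by
    intro x hx
    by_cases hxr : x ∈ ray s θ
    · have hxc := ray_subset_closedRay s θ hxr
      rw [indicator_of_mem hxr]
      exact truncate_eq_zero n (le_of_lt (hball ⟨hdist x hxc hx, hxc⟩))
    · exact indicator_of_notMem hxr _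
  refine ⟨contDiff_iff_contDiffAt.2 fun x => ?_, ?_, θ', hθ', hzero⟩
  · by_cases hxr : x ∈ ray s θ
    · have hnhds := (isOpen_ray s θ).mem_nhds hxr
      have h1 : ContDiffAt ℝ 1 (fun x => truncate n (g x)) x :=
        (contDiff_truncate n).contDiffAt.comp x (hg.contDiffOn.contDiffAt hnhds)
      refine h1.congr_of_eventuallyEq ?_
      filter_upwards [hnhds] with y hy using indicator_of_mem hy _
    · have hx' : x ∉ closedRay s θ' := fun h => hxr (closedRay_subset_ray hθ' h)
      refine (contDiffAt_const (c := (0 : ℝ))).congr_of_eventuallyEq ?_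
      filter_upwards [(isClosed_closedRay s θ').isOpen_compl.mem_nhds hx'] with y hy
      exact hzero y fun h => hy (ray_subset_closedRay s θ' h)
  · obtain ⟨M, hM⟩ := exists_abs_truncate_le n
    refine ⟨M, fun x => ?_⟩
    by_cases hxr : x ∈ ray s θ
    · rw [indicator_of_mem hxr]; exact hM _
    · rw [indicator_of_notMem hxr, abs_zero]; exact (abs_nonneg _).trans (hM 0)

theorem IsTestFun.continuous {g : ℝ → ℝ} (hg : IsTestFun s θ g) : Continuous g :=
  hg.contDiff.continuous

theorem IsTestFun.eq_zero_of_notMem {g : ℝ → ℝ} (hg : IsTestFun s θ g) {x : ℝ}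
    (hx : x ∉ ray s θ) : g x = 0 := by
  obtain ⟨θ', hθ', h⟩ := hg.eq_zero
  exact h x fun hx' => hx (closedRay_subset_ray hθ' (ray_subset_closedRay s θ' hx'))

theorem IsTestFun.deriv_eq_zero_of_notMem {g : ℝ → ℝ} (hg : IsTestFun s θ g) {x : ℝ}
    (hx : x ∉ ray s θ) : deriv g x = 0 := by
  obtain ⟨θ', hθ', h⟩ := hg.eq_zero
  have hx' : x ∉ closedRay s θ' := fun h => hx (closedRay_subset_ray hθ' h)
  have : g =ᶠ[𝓝 x] fun _ => 0 := by
    filter_upwards [(isClosed_closedRay s θ').isOpen_compl.mem_nhds hx'] with y hy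
    exact h y fun h => hy (ray_subset_closedRay s θ' h)
  rw [this.deriv_eq, deriv_const]

theorem IsTestFun.integrable (h : Admissible a b) {g : ℝ → ℝ} (hg : IsTestFun s θ g) :
    Integrable g (invMeasure a b) := by
  have := h.isProbabilityMeasure
  obtain ⟨M, hM⟩ := hg.bounded
  exact Integrable.of_bound hg.continuous.aestronglyMeasurable M (ae_of_all _ hM)

theorem IsTestFun.integrable_sq (h : Admissible a b) {g : ℝ → ℝ} (hg : IsTestFun s θ g) :
    Integrable (fun x => g x ^ 2) (invMeasure a b) := by
  have := h.isProbabilityMeasure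
  obtain ⟨M, hM⟩ := hg.bounded
  refine Integrable.of_bound (hg.continuous.pow 2).aestronglyMeasurable (M ^ 2)
    (ae_of_all _ fun x => ?_)
  rw [norm_pow, Real.norm_eq_abs]
  exact pow_le_pow_left₀ (abs_nonneg _) (hM x) 2

theorem IsTestFun.lintegral_sq (h : Admissible a b) {g : ℝ → ℝ} (hg : IsTestFun s θ g) :
    ∫⁻ x, ENNReal.ofReal (g x ^ 2) ∂(invMeasure a b) =
      ENNReal.ofReal (∫ x, g x ^ 2 ∂(invMeasure a b)) :=
  (ofReal_integral_eq_lintegral_ofReal (hg.integrable_sq h)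
    (ae_of_all _ fun _ => sq_nonneg _)).symm

theorem IsTestFun.setLIntegral_sq {g : ℝ → ℝ} (hg : IsTestFun s θ g) (μ : Measure ℝ) :
    ∫⁻ x in ray s θ, ENNReal.ofReal (g x ^ 2) ∂μ = ∫⁻ x, ENNReal.ofReal (g x ^ 2) ∂μ := by
  refine setLIntegral_eq_of_support_subset fun x hx => ?_
  by_contra hxr
  exact hx (by simp [hg.eq_zero_of_notMem hxr])

theorem IsTestFun.setLIntegral_deriv {g : ℝ → ℝ} (hg : IsTestFun s θ g) :
    ∫⁻ x in ray s θ, ENNReal.ofReal (a x * deriv g x ^ 2) ∂(invMeasure a b) = energy a b g := by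
  refine setLIntegral_eq_of_support_subset fun x hx => ?_
  by_contra hxr
  exact hx (by simp [hg.deriv_eq_zero_of_notMem hxr])

/-- Truncation: a Poincaré inequality for test functions extends to all functions on the half-line
that vanish at the end point. -/
theorem poincare_of_isTestFun {L : ℝ≥0∞} (h : Admissible a b)
    (hL : ∀ g, IsTestFun s θ g →
      L * ∫⁻ x, ENNReal.ofReal (g x ^ 2) ∂(invMeasure a b) ≤ energy a b g)
    {g : ℝ → ℝ} (hg : IsHalfLineFun s θ g) :
    L * ∫⁻ x in ray s θ, ENNReal.ofReal (g x ^ 2) ∂(invMeasure a b) ≤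
      ∫⁻ x in ray s θ, ENNReal.ofReal (a x * deriv g x ^ 2) ∂(invMeasure a b) := by
  set μ := invMeasure a b
  set D := ∫⁻ x in ray s θ, ENNReal.ofReal (a x * deriv g x ^ 2) ∂μ
  set G : ℕ → ℝ → ℝ := fun n => (ray s θ).indicator fun x => truncate n (g x)
  have hG : ∀ n, IsTestFun s θ (G n) := hg.isTestFun_truncate
  have hbound : ∀ n, L * ∫⁻ x in ray s θ, ENNReal.ofReal (G n x ^ 2) ∂μ ≤ D := by
    intro n
    rw [(hG n).setLIntegral_sq]
    refine (hL _ (hG n)).trans ?_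
    rw [← (hG n).setLIntegral_deriv]
    refine setLIntegral_mono' (measurableSet_ray s θ) fun x hx => ENNReal.ofReal_le_ofReal ?_
    refine mul_le_mul_of_nonneg_left ?_ (h.a_pos x).le
    have hd : deriv (G n) x = truncateDeriv n (g x) * deriv g x := by
      have : G n =ᶠ[𝓝 x] fun x => truncate n (g x) := by
        filter_upwards [(isOpen_ray s θ).mem_nhds hx] with y hy using indicator_of_mem hy _
      rw [this.deriv_eq]
      exact ((hasDerivAt_truncate n (g x)).comp x (hg.hasDerivAt hx)).deriv
    rw [hd, mul_pow]
    exact mul_le_of_le_one_left (sq_nonneg _)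
      (pow_le_one₀ (truncateDeriv_nonneg _ _) (truncateDeriv_le_one _ _))
  have hfatou : ∫⁻ x in ray s θ, ENNReal.ofReal (g x ^ 2) ∂μ ≤
      liminf (fun n => ∫⁻ x in ray s θ, ENNReal.ofReal (G n x ^ 2) ∂μ) atTop := by
    refine le_trans (le_of_eq (setLIntegral_congr_fun (measurableSet_ray s θ) fun x hx => ?_))
      (lintegral_liminf_le fun n => ((hG n).continuous.pow 2).measurable.ennreal_ofReal)
    refine (Tendsto.liminf_eq ?_).symm
    simp only [G, indicator_of_mem hx]
    exact ENNReal.tendsto_ofReal ((tendsto_truncate (g x)).pow 2)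
  rcases eq_or_ne L 0 with rfl | hL0
  · simp
  rcases eq_or_ne D ⊤ with hD | hD
  · rw [hD]; exact le_top
  rw [mul_comm, ← ENNReal.le_div_iff_mul_le (Or.inl hL0) (Or.inr hD)]
  refine hfatou.trans ?_
  refine (liminf_le_liminf (v := fun _ => D / L) (.of_forall fun n => ?_)).trans (by simp)
  exact (ENNReal.le_div_iff_mul_le (Or.inl hL0) (Or.inr hD)).2 (mul_comm L _ ▸ hbound n)

theorem lintegral_sq_eq_one {μ : Measure ℝ} {f : ℝ → ℝ} (hf : ∫ x, f x ^ 2 ∂μ = 1) :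
    ∫⁻ x, ENNReal.ofReal (f x ^ 2) ∂μ = 1 := by
  rw [← ofReal_integral_eq_lintegral_ofReal (integrable_of_integral_eq_one hf)
    (ae_of_all _ fun x => sq_nonneg _), hf, ENNReal.ofReal_one]

/-- `L ≤ λ₀` is a Poincaré inequality for test functions. -/
theorem le_lambdaZero_iff (h : Admissible a b) {L : ℝ≥0∞} :
    L ≤ lambdaZero a b s θ ↔ ∀ g, IsTestFun s θ g →
      L * ∫⁻ x, ENNReal.ofReal (g x ^ 2) ∂(invMeasure a b) ≤ energy a b g := by
  constructor
  · intro hL g hg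
    rw [hg.lintegral_sq h]
    set c := ∫ x, g x ^ 2 ∂(invMeasure a b) with hc
    have hc0 : 0 ≤ c := integral_nonneg fun x => sq_nonneg _
    rcases hc0.eq_or_lt with hc0 | hc0
    · simp [← hc0]
    have hmem : lambdaZero a b s θ ≤ energy a b fun x => (√c)⁻¹ * g x := by
      refine sInf_le ⟨fun x => (√c)⁻¹ * g x, fun x hx => by simp [hg.eq_zero_of_notMem hx],
        (continuous_const.mul hg.continuous).continuousOn,
        (contDiff_const.mul hg.contDiff).contDiffOn, ?_, rfl⟩
      simp_rw [mul_pow, inv_pow, Real.sq_sqrt hc0.le]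
      rw [integral_const_mul, inv_mul_cancel₀ hc0.ne']
    have henergy : (energy a b fun x => (√c)⁻¹ * g x) = ENNReal.ofReal c⁻¹ * energy a b g := by
      rw [energy, energy, ← lintegral_const_mul' _ _ ENNReal.ofReal_ne_top]
      refine lintegral_congr fun x => ?_
      rw [deriv_const_mul _ (hg.contDiff.differentiable one_ne_zero x),
        ← ENNReal.ofReal_mul (inv_nonneg.2 hc0.le), mul_pow, inv_pow, Real.sq_sqrt hc0.le]
      ring_nf
    rw [henergy] at hmem
    calc L * ENNReal.ofReal c ≤ ENNReal.ofReal c⁻¹ * energy a b g * ENNReal.ofReal c := by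
          gcongr; exact hL.trans hmem
      _ = energy a b g := by
          rw [mul_right_comm, ← ENNReal.ofReal_mul (inv_nonneg.2 hc0.le),
            inv_mul_cancel₀ hc0.ne', ENNReal.ofReal_one, one_mul]
  · intro hL
    refine le_sInf ?_
    rintro _ ⟨f, hf0, hfc, hfd, hf1, rfl⟩
    have hg : IsHalfLineFun s θ f := ⟨hfc, hfd, hf0 θ (notMem_ray_self s θ)⟩
    have := poincare_of_isTestFun h hL hg
    rw [setLIntegral_eq_of_support_subset (f := fun x => ENNReal.ofReal (f x ^ 2)),
      lintegral_sq_eq_one hf1, mul_one] at this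
    · exact this.trans (setLIntegral_le_lintegral _ _)
    · intro x hx
      by_contra hxr
      exact hx (by simp [hf0 x hxr])

theorem lambdaZero_poincare (h : Admissible a b) {g : ℝ → ℝ} (hg : IsHalfLineFun s θ g) :
    lambdaZero a b s θ * ∫⁻ x in ray s θ, ENNReal.ofReal (g x ^ 2) ∂(invMeasure a b) ≤
      ∫⁻ x in ray s θ, ENNReal.ofReal (a x * deriv g x ^ 2) ∂(invMeasure a b) :=
  poincare_of_isTestFun h ((le_lambdaZero_iff h).1 le_rfl) hg

theorem le_lambdaZero_of_poincare (h : Admissible a b) {L : ℝ≥0∞}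
    (hL : ∀ g, IsHalfLineFun s θ g →
      L * ∫⁻ x in ray s θ, ENNReal.ofReal (g x ^ 2) ∂(invMeasure a b) ≤
        ∫⁻ x in ray s θ, ENNReal.ofReal (a x * deriv g x ^ 2) ∂(invMeasure a b)) :
    L ≤ lambdaZero a b s θ := by
  refine (le_lambdaZero_iff h).2 fun g hg => ?_
  rw [← hg.setLIntegral_sq, ← hg.setLIntegral_deriv]
  exact hL g ⟨hg.continuous.continuousOn, hg.contDiff.contDiffOn,
    hg.eq_zero_of_notMem (notMem_ray_self s θ)⟩

end TestFunctions

section SpectralGap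

variable {a b : ℝ → ℝ}

theorem integral_sub_mul_add {μ : Measure ℝ} {p q r : ℝ → ℝ} (hp : Integrable p μ)
    (hq : Integrable q μ) (hr : Integrable r μ) (k : ℝ) :
    ∫ x, (p x - k * q x + r x) ∂μ = ∫ x, p x ∂μ - k * ∫ x, q x ∂μ + ∫ x, r x ∂μ := by
  have h1 : Integrable (fun x => k * q x) μ := hq.const_mul k
  have h2 : Integrable (fun x => p x - k * q x) μ := hp.sub h1
  rw [integral_add h2 hr, integral_sub hp h1, integral_const_mul]

theorem energy_mul_sub (f : ℝ → ℝ) (k c : ℝ) :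
    (energy a b fun x => k * (f x - c)) = ENNReal.ofReal (k ^ 2) * energy a b f := by
  rw [energy, energy, ← lintegral_const_mul' _ _ ENNReal.ofReal_ne_top]
  refine lintegral_congr fun x => ?_
  rw [← ENNReal.ofReal_mul (sq_nonneg k), deriv_const_mul_field, deriv_sub_const]
  ring_nf

/-- The Poincaré inequality for the spectral gap. -/
theorem lambdaOne_mul_variance_le (h : Admissible a b) {g : ℝ → ℝ} (hg : ContDiff ℝ 1 g)
    (hg1 : Integrable g (invMeasure a b)) (hg2 : Integrable (fun x => g x ^ 2) (invMeasure a b)) :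
    lambdaOne a b * ENNReal.ofReal
      (∫ x, g x ^ 2 ∂(invMeasure a b) - (∫ x, g x ∂(invMeasure a b)) ^ 2) ≤ energy a b g := by
  have := h.isProbabilityMeasure
  set μ := invMeasure a b
  set m := ∫ x, g x ∂μ with hm
  set v := ∫ x, g x ^ 2 ∂μ - m ^ 2 with hv
  rcases le_or_gt v 0 with hv0 | hv0
  · simp [ENNReal.ofReal_of_nonpos hv0]
  have hvar : ∫ x, (g x - m) ^ 2 ∂μ = v := by
    have : ∀ x, (g x - m) ^ 2 = g x ^ 2 - 2 * m * g x + m ^ 2 := fun x => by ring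
    simp_rw [this]
    rw [integral_sub_mul_add hg2 hg1 (integrable_const _), ← hm]
    simp only [integral_const, probReal_univ, smul_eq_mul]
    rw [hv]; ring
  have hle : lambdaOne a b ≤ energy a b fun x => (√v)⁻¹ * (g x - m) := by
    refine sInf_le ⟨_, contDiff_const.mul (hg.sub contDiff_const), ?_, ?_, rfl⟩
    · rw [integral_const_mul, integral_sub hg1 (integrable_const _)]
      simp [hm, μ]
    · simp_rw [mul_pow, inv_pow, Real.sq_sqrt hv0.le]
      rw [integral_const_mul, hvar, inv_mul_cancel₀ hv0.ne']
  rw [energy_mul_sub, inv_pow, Real.sq_sqrt hv0.le] at hle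
  calc lambdaOne a b * ENNReal.ofReal v
      ≤ ENNReal.ofReal v⁻¹ * energy a b g * ENNReal.ofReal v := by gcongr
    _ = energy a b g := by
        rw [mul_right_comm, ← ENNReal.ofReal_mul (inv_nonneg.2 hv0.le),
          inv_mul_cancel₀ hv0.ne', ENNReal.ofReal_one, one_mul]

theorem lintegral_eq_add_ray (a b : ℝ → ℝ) (θ : ℝ) (f : ℝ → ℝ≥0∞) :
    ∫⁻ x, f x ∂(invMeasure a b) =
      ∫⁻ x in ray .plus θ, f x ∂(invMeasure a b) + ∫⁻ x in ray .minus θ, f x ∂(invMeasure a b) := by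
  rw [← lintegral_add_compl f (measurableSet_ray .plus θ)]
  congr 1
  have hcompl : (ray .plus θ)ᶜ = closedRay .minus θ := compl_Ioi
  rw [hcompl]
  refine setLIntegral_congr (ae_eq_set.2 ⟨?_, ?_⟩)
  · refine measure_mono_null (fun x hx => ?_) (invMeasure_singleton a b θ)
    exact (mem_closedRay_iff.1 hx.1).resolve_right hx.2
  · rw [sdiff_eq_empty.2 (ray_subset_closedRay .minus θ), measure_empty]

theorem inf_lambdaZero_le_lambdaOne (h : Admissible a b) (θ : ℝ) :
    lambdaZero a b .plus θ ⊓ lambdaZero a b .minus θ ≤ lambdaOne a b := by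
  have := h.isProbabilityMeasure
  refine le_sInf ?_
  rintro _ ⟨f, hf, hf0, hf1, rfl⟩
  set L := lambdaZero a b .plus θ ⊓ lambdaZero a b .minus θ
  have hside : ∀ s, L * ∫⁻ x in ray s θ, ENNReal.ofReal ((f x - f θ) ^ 2) ∂(invMeasure a b) ≤
      ∫⁻ x in ray s θ, ENNReal.ofReal (a x * deriv f x ^ 2) ∂(invMeasure a b) := by
    intro s
    have hg : IsHalfLineFun s θ fun x => f x - f θ :=
      ⟨(hf.continuous.sub continuous_const).continuousOn, (hf.sub contDiff_const).contDiffOn,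
        sub_self _⟩
    have := lambdaZero_poincare h hg
    simp_rw [deriv_sub_const] at this
    refine le_trans ?_ this
    gcongr
    cases s
    exacts [inf_le_left, inf_le_right]
  have hone : 1 ≤ ∫⁻ x, ENNReal.ofReal ((f x - f θ) ^ 2) ∂(invMeasure a b) := by
    have hint2 := integrable_of_integral_eq_one hf1
    have hint : Integrable f (invMeasure a b) :=
      ((memLp_two_iff_integrable_sq hf.continuous.aestronglyMeasurable).2 hint2).integrable
        one_le_two
    have hexp : ∀ x, (f x - f θ) ^ 2 = f x ^ 2 - 2 * f θ * f x + f θ ^ 2 := fun x => by ring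
    have hi : Integrable (fun x => (f x - f θ) ^ 2) (invMeasure a b) := by
      simp_rw [hexp]
      exact (hint2.sub (hint.const_mul _)).add (integrable_const _)
    rw [← ofReal_integral_eq_lintegral_ofReal hi (ae_of_all _ fun x => sq_nonneg _),
      ENNReal.one_le_ofReal]
    simp_rw [hexp]
    rw [integral_sub_mul_add hint2 hint (integrable_const _), hf0, hf1]
    simp [sq_nonneg]
  calc L = L * 1 := (mul_one _).symm
    _ ≤ L * ∫⁻ x, ENNReal.ofReal ((f x - f θ) ^ 2) ∂(invMeasure a b) := by gcongr
    _ ≤ energy a b f := by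
      rw [energy, lintegral_eq_add_ray a b θ, lintegral_eq_add_ray a b θ, mul_add]
      exact add_le_add (hside _) (hside _)

theorem exists_isTestFun_of_lambdaZero_lt (h : Admissible a b) {s : Side} {θ : ℝ} {L : ℝ≥0∞}
    (hL : lambdaZero a b s θ < L) : ∃ g, IsTestFun s θ g ∧
      energy a b g < L * ENNReal.ofReal (∫ x, g x ^ 2 ∂(invMeasure a b)) := by
  by_contra! hne
  refine hL.not_ge ((le_lambdaZero_iff h).2 fun g hg => ?_)
  rw [hg.lintegral_sq h]
  exact hne g hg

theorem lambdaOne_le_sup_lambdaZero (h : Admissible a b) (θ : ℝ) :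
    lambdaOne a b ≤ lambdaZero a b .plus θ ⊔ lambdaZero a b .minus θ := by
  by_contra! hlt
  obtain ⟨f, hf, hfL⟩ := exists_isTestFun_of_lambdaZero_lt h (le_sup_left.trans_lt hlt)
  obtain ⟨g, hg, hgL⟩ := exists_isTestFun_of_lambdaZero_lt h (le_sup_right.trans_lt hlt)
  set μ := invMeasure a b
  obtain ⟨c, d, hcd, hmean⟩ : ∃ c d : ℝ, (c ≠ 0 ∨ d ≠ 0) ∧
      c * ∫ x, f x ∂μ + d * ∫ x, g x ∂μ = 0 := by
    by_cases h0 : ∫ x, f x ∂μ = 0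
    · exact ⟨1, 0, Or.inl one_ne_zero, by simp [h0]⟩
    · exact ⟨-∫ x, g x ∂μ, ∫ x, f x ∂μ, Or.inr h0, by ring⟩
  have hfg : ∀ x, f x = 0 ∨ g x = 0 := fun x => by
    rcases le_or_gt x θ with hx | hx
    · exact Or.inl (hf.eq_zero_of_notMem (not_lt.2 hx))
    · exact Or.inr (hg.eq_zero_of_notMem (not_lt.2 hx.le))
  have hfg' : ∀ x, deriv f x = 0 ∨ deriv g x = 0 := fun x => by
    rcases le_or_gt x θ with hx | hx
    · exact Or.inl (hf.deriv_eq_zero_of_notMem (not_lt.2 hx))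
    · exact Or.inr (hg.deriv_eq_zero_of_notMem (not_lt.2 hx.le))
  have hsq : ∀ x, (c * f x + d * g x) ^ 2 = c ^ 2 * f x ^ 2 + d ^ 2 * g x ^ 2 := fun x => by
    rcases hfg x with h0 | h0 <;> rw [h0] <;> ring
  have hsq_int : ∫ x, (c * f x + d * g x) ^ 2 ∂μ =
      c ^ 2 * ∫ x, f x ^ 2 ∂μ + d ^ 2 * ∫ x, g x ^ 2 ∂μ := by
    simp_rw [hsq]
    rw [integral_add ((hf.integrable_sq h).const_mul _) ((hg.integrable_sq h).const_mul _),
      integral_const_mul, integral_const_mul]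
  have hint2 : Integrable (fun x => (c * f x + d * g x) ^ 2) μ := by
    simp_rw [hsq]
    exact ((hf.integrable_sq h).const_mul _).add ((hg.integrable_sq h).const_mul _)
  have henergy : (energy a b fun x => c * f x + d * g x) =
      ENNReal.ofReal (c ^ 2) * energy a b f + ENNReal.ofReal (d ^ 2) * energy a b g := by
    rw [energy, energy, energy, ← lintegral_const_mul' _ _ ENNReal.ofReal_ne_top,
      ← lintegral_const_mul' _ _ ENNReal.ofReal_ne_top, ← lintegral_add_left]
    · refine lintegral_congr fun x => ?_
      have hd : deriv (fun x => c * f x + d * g x) x = c * deriv f x + d * deriv g x := by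
        have h1 := (hf.contDiff.differentiable one_ne_zero x).hasDerivAt.const_mul c
        have h2 := (hg.contDiff.differentiable one_ne_zero x).hasDerivAt.const_mul d
        exact (h1.add h2).deriv
      rw [hd, ← ENNReal.ofReal_mul (sq_nonneg _), ← ENNReal.ofReal_mul (sq_nonneg _),
        ← ENNReal.ofReal_add (mul_nonneg (sq_nonneg _) (mul_nonneg (h.a_pos x).le (sq_nonneg _)))
          (mul_nonneg (sq_nonneg _) (mul_nonneg (h.a_pos x).le (sq_nonneg _)))]
      rcases hfg' x with h0 | h0 <;> rw [h0] <;> ring_nf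
    · exact measurable_const.mul
        (h.continuous_a.measurable.mul ((measurable_deriv f).pow_const 2)).ennreal_ofReal
  have hmain := lambdaOne_mul_variance_le h
    ((contDiff_const.mul hf.contDiff).add (contDiff_const.mul hg.contDiff))
    (((hf.integrable h).const_mul c).add ((hg.integrable h).const_mul d)) hint2
  have hmean' : ∫ x, c * f x + d * g x ∂μ = 0 := by
    rw [integral_add ((hf.integrable h).const_mul c) ((hg.integrable h).const_mul d),
      integral_const_mul, integral_const_mul, hmean]
  rw [hmean', hsq_int, henergy] at hmain
  have hf2 : 0 ≤ ∫ x, f x ^ 2 ∂μ := integral_nonneg fun x => sq_nonneg _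
  have hg2 : 0 ≤ ∫ x, g x ^ 2 ∂μ := integral_nonneg fun x => sq_nonneg _
  have hexp : lambdaOne a b * ENNReal.ofReal
      (c ^ 2 * ∫ x, f x ^ 2 ∂μ + d ^ 2 * ∫ x, g x ^ 2 ∂μ - 0 ^ 2) =
      ENNReal.ofReal (c ^ 2) * (lambdaOne a b * ENNReal.ofReal (∫ x, f x ^ 2 ∂μ)) +
      ENNReal.ofReal (d ^ 2) * (lambdaOne a b * ENNReal.ofReal (∫ x, g x ^ 2 ∂μ)) := by
    rw [zero_pow two_ne_zero, sub_zero, ENNReal.ofReal_add (by positivity) (by positivity),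
      ENNReal.ofReal_mul (sq_nonneg _), ENNReal.ofReal_mul (sq_nonneg _)]
    ring
  rw [hexp] at hmain
  refine hmain.not_gt ?_
  have hmul_le : ∀ (k : ℝ) {x y : ℝ≥0∞}, x < y →
      ENNReal.ofReal (k ^ 2) * x ≤ ENNReal.ofReal (k ^ 2) * y := fun k x y hxy => by gcongr
  have hmul_lt : ∀ {k : ℝ} {x y : ℝ≥0∞}, k ≠ 0 → x < y →
      ENNReal.ofReal (k ^ 2) * x < ENNReal.ofReal (k ^ 2) * y := fun {k x y} hk hxy =>
    (ENNReal.mul_lt_mul_iff_right (by simpa using hk) ENNReal.ofReal_ne_top).2 hxy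
  have hne : ∀ (k : ℝ) {x y : ℝ≥0∞}, x < y → ENNReal.ofReal (k ^ 2) * x ≠ ⊤ := fun k x y hxy =>
    ENNReal.mul_ne_top ENNReal.ofReal_ne_top hxy.ne_top
  rcases hcd with hc | hd
  · exact ENNReal.add_lt_add_of_lt_of_le (hne d hgL) (hmul_lt hc hfL) (hmul_le d hgL)
  · exact ENNReal.add_lt_add_of_le_of_lt (hne c hfL) (hmul_le c hfL) (hmul_lt hd hgL)

theorem lambdaOne_le_two_mul_lambdaZero (h : Admissible a b) {s : Side} {m : ℝ}
    (hm : invMeasure a b (ray s m) ≤ 1 / 2) : lambdaOne a b ≤ 2 * lambdaZero a b s m := by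
  have := h.isProbabilityMeasure
  set μ := invMeasure a b
  suffices hsuff : lambdaOne a b / 2 ≤ lambdaZero a b s m by
    rw [mul_comm]
    exact (ENNReal.div_le_iff (by simp) (by simp)).1 hsuff
  refine (le_lambdaZero_iff h).2 fun g hg => ?_
  have hmain := lambdaOne_mul_variance_le h hg.contDiff (hg.integrable h) (hg.integrable_sq h)
  refine le_trans ?_ hmain
  rw [hg.lintegral_sq h, ENNReal.div_eq_inv_mul, mul_comm _ (lambdaOne a b), mul_assoc]
  refine mul_le_mul_right ?_ _
  have h2 : (2 : ℝ≥0∞)⁻¹ = ENNReal.ofReal 2⁻¹ := by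
    rw [ENNReal.ofReal_inv_of_pos two_pos, ENNReal.ofReal_ofNat]
  rw [h2, ← ENNReal.ofReal_mul (by norm_num)]
  refine ENNReal.ofReal_le_ofReal ?_
  set c := ∫ x, g x ∂μ with hc
  have hreal : μ.real (ray s m) ≤ 1 / 2 := by
    have := ENNReal.toReal_mono (by simp) hm
    simpa [Measure.real] using this
  have hind : Integrable ((ray s m).indicator fun _ => (1 : ℝ)) μ :=
    (integrable_const _).indicator (measurableSet_ray s m)
  have hnonneg : 0 ≤ ∫ x, (g x - 2 * c * (ray s m).indicator (fun _ => (1 : ℝ)) x) ^ 2 ∂μ :=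
    integral_nonneg fun x => sq_nonneg _
  have hexp : ∀ x, (g x - 2 * c * (ray s m).indicator (fun _ => (1 : ℝ)) x) ^ 2 =
      g x ^ 2 - 4 * c * g x + 4 * c ^ 2 * (ray s m).indicator (fun _ => (1 : ℝ)) x := by
    intro x
    by_cases hx : x ∈ ray s m
    · rw [indicator_of_mem hx]; ring
    · rw [indicator_of_notMem hx, hg.eq_zero_of_notMem hx]; ring
  simp_rw [hexp] at hnonneg
  rw [integral_sub_mul_add (hg.integrable_sq h) (hg.integrable h) (hind.const_mul _),
    integral_const_mul, integral_indicator_const _ (measurableSet_ray s m), ← hc, smul_eq_mul,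
    mul_one] at hnonneg
  have := mul_le_mul_of_nonneg_left hreal (sq_nonneg c)
  change 2⁻¹ * ∫ x, g x ^ 2 ∂μ ≤ ∫ x, g x ^ 2 ∂μ - c ^ 2
  linarith

theorem IsMedian.measure_ray_le {μ : Measure ℝ} [IsProbabilityMeasure μ] {m : ℝ}
    (hm : IsMedian μ m) (s : Side) : μ (ray s m) ≤ 1 / 2 := by
  have key : ∀ t : Set ℝ, MeasurableSet t → 1 / 2 ≤ μ t → μ tᶜ ≤ 1 / 2 := fun t ht h2 => by
    rw [prob_compl_eq_one_sub ht]
    refine (tsub_le_tsub_left h2 1).trans (le_of_eq ?_)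
    simp
  cases s
  · simpa [ray] using key _ measurableSet_Iic hm.1
  · simpa [ray] using key _ measurableSet_Ici hm.2

end SpectralGap

section CauchySchwarz

theorem sq_lintegral_mul_le {α : Type*} [MeasurableSpace α] (μ : Measure α) {f g : α → ℝ≥0∞}
    (hf : AEMeasurable f μ) (hg : AEMeasurable g μ) :
    (∫⁻ x, f x * g x ∂μ) ^ 2 ≤ (∫⁻ x, f x ^ 2 ∂μ) * ∫⁻ x, g x ^ 2 ∂μ := by
  have := ENNReal.lintegral_mul_le_Lp_mul_Lq μ Real.HolderConjugate.two_two hf hg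
  have h2 := pow_le_pow_left' this 2
  rw [mul_pow, ← ENNReal.rpow_natCast, ← ENNReal.rpow_natCast, ← ENNReal.rpow_natCast,
    ← ENNReal.rpow_mul, ← ENNReal.rpow_mul] at h2
  norm_num at h2
  exact h2

/-- The Cauchy–Schwarz inequality with a weight. -/
theorem sq_lintegral_le_div_mul {α : Type*} [MeasurableSpace α] (μ : Measure α) {f w : α → ℝ≥0∞}
    (hf : AEMeasurable f μ) (hw : AEMeasurable w μ) (hw0 : ∀ᵐ x ∂μ, w x ≠ 0)
    (hwt : ∀ᵐ x ∂μ, w x ≠ ⊤) :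
    (∫⁻ x, f x ∂μ) ^ 2 ≤ (∫⁻ x, f x ^ 2 / w x ∂μ) * ∫⁻ x, w x ∂μ := by
  have key := sq_lintegral_mul_le μ (f := fun x => f x / w x ^ (1 / 2 : ℝ))
    (g := fun x => w x ^ (1 / 2 : ℝ)) (hf.div (hw.pow_const _)) (hw.pow_const _)
  have hsq : ∀ x, (w x ^ (1 / 2 : ℝ)) ^ 2 = w x := fun x => by
    rw [← ENNReal.rpow_natCast, ← ENNReal.rpow_mul]; norm_num
  convert key using 2
  · refine lintegral_congr_ae ?_
    filter_upwards [hw0, hwt] with x h0 ht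
    rw [ENNReal.div_mul_cancel]
    · simp [h0, ht]
    · simp [h0, ht]
  · refine lintegral_congr fun x => ?_
    rw [div_eq_mul_inv, div_eq_mul_inv, mul_pow, ← ENNReal.inv_pow, hsq]
  · exact lintegral_congr fun x => (hsq x).symm

/-- Tonelli's theorem on the triangle `θ < y < x`. -/
theorem lintegral_Ioi_mul_lintegral_Ioc (θ : ℝ) {F q : ℝ → ℝ≥0∞}
    (hF : AEMeasurable F (volume.restrict (Ioi θ)))
    (hq : AEMeasurable q (volume.restrict (Ioi θ))) :
    ∫⁻ x in Ioi θ, F x * ∫⁻ y in Ioc θ x, q y =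
      ∫⁻ y in Ioi θ, q y * ∫⁻ x in Ioi y, F x := by
  have hmeas : AEMeasurable (Function.uncurry fun x y => (Iio x).indicator (fun y => F x * q y) y)
      ((volume.restrict (Ioi θ)).prod (volume.restrict (Ioi θ))) := by
    have h1 : AEMeasurable (fun z : ℝ × ℝ => F z.1 * q z.2)
        ((volume.restrict (Ioi θ)).prod (volume.restrict (Ioi θ))) :=
      (hF.comp_fst).mul (hq.comp_snd)
    exact h1.indicator (measurableSet_lt measurable_snd measurable_fst)
  calc ∫⁻ x in Ioi θ, F x * ∫⁻ y in Ioc θ x, q y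
      = ∫⁻ x in Ioi θ, ∫⁻ y in Ioi θ, (Iio x).indicator (fun y => F x * q y) y := by
        refine setLIntegral_congr_fun measurableSet_Ioi fun x _ => ?_
        rw [setLIntegral_indicator measurableSet_Iio, Iio_inter_Ioi,
          ← setLIntegral_congr (Ioo_ae_eq_Ioc (a := θ) (b := x)), lintegral_const_mul'']
        exact hq.mono_measure (Measure.restrict_mono_set _ fun y hy => hy.1)
    _ = ∫⁻ y in Ioi θ, ∫⁻ x in Ioi θ, (Iio x).indicator (fun y => F x * q y) y :=
        lintegral_lintegral_swap hmeas
    _ = ∫⁻ y in Ioi θ, q y * ∫⁻ x in Ioi y, F x := by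
        refine setLIntegral_congr_fun measurableSet_Ioi fun y hy => ?_
        have : ∀ x, (Iio x).indicator (fun y => F x * q y) y =
            (Ioi y).indicator (fun x => F x * q y) x := fun x => by
          simp only [indicator, mem_Iio, mem_Ioi]
        simp_rw [this]
        rw [setLIntegral_indicator measurableSet_Ioi, inter_eq_left.2 (Ioi_subset_Ioi (le_of_lt hy)),
          lintegral_mul_const'', mul_comm]
        exact hF.mono_measure (Measure.restrict_mono_set _ (Ioi_subset_Ioi (le_of_lt hy)))

end CauchySchwarz

section HalfLine

variable {a b : ℝ → ℝ} {s : Side} {θ : ℝ}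

/-- The scale density `e^{-C}` as an extended nonnegative function. -/
noncomputable def scale (a b : ℝ → ℝ) (x : ℝ) : ℝ≥0∞ := ENNReal.ofReal (Real.exp (-potential a b x))

/-- The speed density `e^C / a` as an extended nonnegative function. -/
noncomputable def speed (a b : ℝ → ℝ) (x : ℝ) : ℝ≥0∞ := ENNReal.ofReal (speedDensity a b x)

theorem scale_ne_zero (a b : ℝ → ℝ) (x : ℝ) : scale a b x ≠ 0 := by
  simp [scale, Real.exp_pos]

theorem scale_ne_top (a b : ℝ → ℝ) (x : ℝ) : scale a b x ≠ ⊤ := ENNReal.ofReal_ne_top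

theorem speed_ne_top (a b : ℝ → ℝ) (x : ℝ) : speed a b x ≠ ⊤ := ENNReal.ofReal_ne_top

theorem Admissible.speed_ne_zero (h : Admissible a b) (x : ℝ) : speed a b x ≠ 0 := by
  simp [speed, h.speedDensity_pos]

theorem Admissible.measurable_scale (h : Admissible a b) : Measurable (scale a b) :=
  h.continuous_scale.measurable.ennreal_ofReal

theorem Admissible.measurable_speed (h : Admissible a b) : Measurable (speed a b) :=
  h.continuous_speedDensity.measurable.ennreal_ofReal

theorem Admissible.lintegral_speed_ne_top (h : Admissible a b) : ∫⁻ x, speed a b x ≠ ⊤ := by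
  simp only [speed, h.lintegral_speedDensity]
  exact ENNReal.ofReal_ne_top

theorem Admissible.lintegral_scale_ne_top (h : Admissible a b) (x y : ℝ) :
    ∫⁻ t in Ioc x y, scale a b t ≠ ⊤ := by
  have hi : IntegrableOn (fun x => Real.exp (-potential a b x)) (Ioc x y) :=
    (h.continuous_scale.integrableOn_Icc (a := x) (b := y)).mono_set Ioc_subset_Icc_self
  simp only [scale]
  rw [← ofReal_integral_eq_lintegral_ofReal hi (ae_of_all _ fun _ => (Real.exp_pos _).le)]
  exact ENNReal.ofReal_ne_top

theorem Admissible.setLIntegral_deriv_invMeasure (h : Admissible a b) (d : ℝ → ℝ) {t : Set ℝ}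
    (ht : MeasurableSet t) :
    ∫⁻ x in t, ENNReal.ofReal (a x * d x ^ 2) ∂(invMeasure a b) =
      ENNReal.ofReal (normConst a b)⁻¹ * ∫⁻ x in t, ENNReal.ofReal (d x ^ 2) / scale a b x := by
  rw [h.setLIntegral_invMeasure _ ht]
  congr 1
  refine lintegral_congr fun x => ?_
  rw [← ENNReal.ofReal_mul (h.speedDensity_pos x).le, scale,
    ← ENNReal.ofReal_div_of_pos (Real.exp_pos _), speedDensity, Real.exp_neg]
  congr 1
  have := (h.a_pos x).ne'
  field_simp

theorem Admissible.setLIntegral_sq_invMeasure (h : Admissible a b) (g : ℝ → ℝ) {t : Set ℝ}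
    (ht : MeasurableSet t) :
    ∫⁻ x in t, ENNReal.ofReal (g x ^ 2) ∂(invMeasure a b) =
      ENNReal.ofReal (normConst a b)⁻¹ * ∫⁻ x in t, ENNReal.ofReal (g x ^ 2) * speed a b x := by
  rw [h.setLIntegral_invMeasure _ ht]
  simp only [speed, mul_comm]

/-- The Poincaré inequality on a half-line in terms of the scale and speed densities. -/
theorem poincare_iff_scale_speed (h : Admissible a b) (L : ℝ≥0∞) (g : ℝ → ℝ) :
    L * ∫⁻ x in ray s θ, ENNReal.ofReal (g x ^ 2) ∂(invMeasure a b) ≤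
      ∫⁻ x in ray s θ, ENNReal.ofReal (a x * deriv g x ^ 2) ∂(invMeasure a b) ↔
    L * ∫⁻ x in ray s θ, ENNReal.ofReal (g x ^ 2) * speed a b x ≤
      ∫⁻ x in ray s θ, ENNReal.ofReal (deriv g x ^ 2) / scale a b x := by
  rw [h.setLIntegral_deriv_invMeasure _ (measurableSet_ray s θ),
    h.setLIntegral_sq_invMeasure _ (measurableSet_ray s θ), mul_left_comm]
  exact ENNReal.mul_le_mul_iff_right (by simpa using h.normConst_pos) ENNReal.ofReal_ne_top

theorem IsHalfLineFun.ofReal_abs_le {g : ℝ → ℝ} (hg : IsHalfLineFun .plus θ g) {x : ℝ}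
    (hx : θ ≤ x) :
    ENNReal.ofReal |g x| ≤ ∫⁻ y in Ioc θ x, ENNReal.ofReal |deriv g y| := by
  rcases eq_or_ne (∫⁻ y in Ioc θ x, ENNReal.ofReal |deriv g y|) ⊤ with htop | htop
  · rw [htop]; exact le_top
  have hint : IntegrableOn (deriv g) (Ioc θ x) := by
    refine ⟨(measurable_deriv g).aestronglyMeasurable, ?_⟩
    rw [hasFiniteIntegral_iff_norm]
    exact lt_top_iff_ne_top.2 htop
  have hftc : ∫ y in θ..x, deriv g y = g x - g θ :=
    intervalIntegral.integral_eq_sub_of_hasDerivAt_of_le hx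
      (hg.continuousOn.mono Icc_subset_Ici_self) (fun y hy => hg.hasDerivAt hy.1)
      ((intervalIntegrable_iff_integrableOn_Ioc_of_le hx).2 hint)
  rw [hg.eq_zero, sub_zero, intervalIntegral.integral_of_le hx] at hftc
  rw [← hftc]
  refine (ENNReal.ofReal_le_ofReal (norm_integral_le_integral_norm (deriv g))).trans ?_
  rw [ofReal_integral_eq_lintegral_ofReal hint.norm (ae_of_all _ fun _ => norm_nonneg _)]
  rfl

/-- The pointwise bound for functions vanishing at the end point by weighted energies. -/
theorem IsHalfLineFun.ofReal_sq_le {g : ℝ → ℝ} (hg : IsHalfLineFun .plus θ g) {w : ℝ → ℝ≥0∞}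
    {x : ℝ} (hx : θ ≤ x) (hw : Measurable w) (hw0 : ∀ y ∈ Ioc θ x, w y ≠ 0)
    (hwt : ∀ y ∈ Ioc θ x, w y ≠ ⊤) :
    ENNReal.ofReal (g x ^ 2) ≤
      (∫⁻ y in Ioc θ x, ENNReal.ofReal (deriv g y ^ 2) / w y) * ∫⁻ y in Ioc θ x, w y := by
  have hsq : ∀ t : ℝ, ENNReal.ofReal (t ^ 2) = ENNReal.ofReal |t| ^ 2 := fun t => by
    rw [← ENNReal.ofReal_pow (abs_nonneg t), sq_abs]
  simp_rw [hsq]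
  refine (pow_le_pow_left' (hg.ofReal_abs_le hx) 2).trans ?_
  refine sq_lintegral_le_div_mul _ ?_ hw.aemeasurable
    (ae_restrict_of_forall_mem measurableSet_Ioc hw0)
    (ae_restrict_of_forall_mem measurableSet_Ioc hwt)
  exact (measurable_deriv g).abs.ennreal_ofReal.aemeasurable

end HalfLine

section Variational

variable {a b : ℝ → ℝ} {θ : ℝ}

theorem tailIntegral_plus (a b f : ℝ → ℝ) (x : ℝ) :
    tailIntegral a b .plus f x = ∫⁻ y in Ioi x, ENNReal.ofReal |f y| * speed a b y := by
  simp only [tailIntegral, ray, speed]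
  exact lintegral_congr fun y => ENNReal.ofReal_mul (abs_nonneg _)

theorem antitone_tailIntegral_plus (a b f : ℝ → ℝ) : Antitone (tailIntegral a b .plus f) :=
  fun _ _ hxy => lintegral_mono_set (Ioi_subset_Ioi hxy)

theorem tailIntegral_plus_ne_zero (h : Admissible a b) {f : ℝ → ℝ} (hf : f ∈ classII .plus θ)
    {x : ℝ} (hx : θ ≤ x) : tailIntegral a b .plus f x ≠ 0 := by
  rw [tailIntegral_plus]
  have hpos : ∀ y ∈ Ioi x, ENNReal.ofReal |f y| * speed a b y ≠ 0 := fun y hy =>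
    mul_ne_zero (by simpa using (hf.2.2 y (lt_of_le_of_lt hx hy)).ne') (h.speed_ne_zero y)
  have hcont : ContinuousOn (fun y => ENNReal.ofReal |f y|) (Ioi x) :=
    ENNReal.continuous_ofReal.comp_continuousOn
      (hf.1.mono fun y hy => (hx.trans_lt hy).le).abs
  have hmeas : AEMeasurable (fun y => ENNReal.ofReal |f y| * speed a b y)
      (volume.restrict (Ioi x)) :=
    (hcont.aemeasurable measurableSet_Ioi).mul h.measurable_speed.aemeasurable
  intro h0
  have hae := (lintegral_eq_zero_iff' hmeas).1 h0
  have hfalse : ∀ᵐ y ∂(volume.restrict (Ioi x)), False := by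
    filter_upwards [hae, ae_restrict_mem measurableSet_Ioi] with y hy hy' using hpos y hy' hy
  rw [ae_iff] at hfalse
  simp at hfalse

/-- The lower bound of `λ₀` by the double-integral operator. -/
theorem varII_le_lambdaZero_plus (h : Admissible a b) (θ : ℝ) :
    varII a b .plus θ ≤ lambdaZero a b .plus θ := by
  refine iSup₂_le fun f hf => ?_
  set A := ⨅ x ∈ ray .plus θ, (opII a b .plus θ f x)⁻¹ with hA
  rcases eq_or_ne A 0 with hA0 | hA0
  · rw [hA0]; exact zero_le
  set T := tailIntegral a b .plus f with hT
  have hTmeas : Measurable T := (antitone_tailIntegral_plus a b f).measurable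
  have hop : ∀ x ∈ Ioi θ, ∫⁻ y in Ioc θ x, scale a b y * T y ≤ A⁻¹ * ENNReal.ofReal |f x| := by
    intro x hx
    have h1 : A ≤ (opII a b .plus θ f x)⁻¹ := iInf₂_le x hx
    have h2 : opII a b .plus θ f x ≤ A⁻¹ := ENNReal.le_inv_iff_le_inv.2 h1
    rw [opII, uIoc_of_le (le_of_lt hx)] at h2
    exact (ENNReal.div_le_iff (by simpa using (hf.2.2 x hx).ne') ENNReal.ofReal_ne_top).1 h2
  have hTtop : ∀ y ∈ Ioi θ, T y ≠ ⊤ := by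
    intro y hy htop
    have hfin : ∫⁻ z in Ioc θ y, scale a b z * T z < ⊤ :=
      (hop y hy).trans_lt (ENNReal.mul_lt_top (ENNReal.inv_lt_top.2 (pos_iff_ne_zero.2 hA0))
        ENNReal.ofReal_lt_top)
    refine hfin.ne (top_le_iff.1 ?_)
    calc (⊤ : ℝ≥0∞) = ∫⁻ z in Ioc θ y, ⊤ := by
          rw [setLIntegral_const, ENNReal.top_mul]
          simpa using hy
      _ ≤ ∫⁻ z in Ioc θ y, scale a b z * T z := by
          refine setLIntegral_mono' measurableSet_Ioc fun z hz => ?_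
          have : T z = ⊤ := top_le_iff.1 (htop ▸ antitone_tailIntegral_plus a b f hz.2)
          rw [this, ENNReal.mul_top (scale_ne_zero a b z)]
  refine le_lambdaZero_of_poincare h fun g hg => (poincare_iff_scale_speed h A g).2 ?_
  set H : ℝ → ℝ≥0∞ := fun y => scale a b y * T y with hH
  have hHmeas : Measurable H := h.measurable_scale.mul hTmeas
  have hH0 : ∀ y ∈ Ioi θ, H y ≠ 0 := fun y hy =>
    mul_ne_zero (scale_ne_zero a b y) (tailIntegral_plus_ne_zero h hf (le_of_lt hy))
  have hHt : ∀ y ∈ Ioi θ, H y ≠ ⊤ := fun y hy =>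
    ENNReal.mul_ne_top (scale_ne_top a b y) (hTtop y hy)
  set q : ℝ → ℝ≥0∞ := fun y => ENNReal.ofReal (deriv g y ^ 2) / H y with hq
  have hqmeas : Measurable q := ((measurable_deriv g).pow_const 2).ennreal_ofReal.div hHmeas
  have hFmeas : AEMeasurable (fun x => ENNReal.ofReal |f x| * speed a b x)
      (volume.restrict (Ioi θ)) := by
    have hcont : ContinuousOn (fun y => ENNReal.ofReal |f y|) (Ioi θ) :=
      ENNReal.continuous_ofReal.comp_continuousOn (hf.1.mono Ioi_subset_Ici_self).abs
    exact (hcont.aemeasurable measurableSet_Ioi).mul h.measurable_speed.aemeasurable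
  have hAt : A⁻¹ ≠ ⊤ := ENNReal.inv_ne_top.2 hA0
  have hmain : ∫⁻ x in Ioi θ, ENNReal.ofReal (g x ^ 2) * speed a b x ≤
      A⁻¹ * ∫⁻ y in Ioi θ, ENNReal.ofReal (deriv g y ^ 2) / scale a b y := by
    calc ∫⁻ x in Ioi θ, ENNReal.ofReal (g x ^ 2) * speed a b x
        ≤ ∫⁻ x in Ioi θ, A⁻¹ * ((ENNReal.ofReal |f x| * speed a b x) *
            ∫⁻ y in Ioc θ x, q y) := by
          refine setLIntegral_mono' measurableSet_Ioi fun x hx => ?_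
          have h1 := hg.ofReal_sq_le (le_of_lt hx) hHmeas (fun y hy => hH0 y hy.1)
            (fun y hy => hHt y hy.1)
          calc ENNReal.ofReal (g x ^ 2) * speed a b x
              ≤ ((∫⁻ y in Ioc θ x, q y) * (A⁻¹ * ENNReal.ofReal |f x|)) * speed a b x := by
                gcongr
                exact h1.trans (by gcongr; exact hop x hx)
            _ = _ := by ring
      _ = A⁻¹ * ∫⁻ y in Ioi θ, q y * T y := by
          rw [lintegral_const_mul' _ _ hAt,
            lintegral_Ioi_mul_lintegral_Ioc θ hFmeas hqmeas.aemeasurable]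
          simp_rw [hT, tailIntegral_plus]
      _ ≤ A⁻¹ * ∫⁻ y in Ioi θ, ENNReal.ofReal (deriv g y ^ 2) / scale a b y := by
          gcongr A⁻¹ * ?_
          refine setLIntegral_mono' measurableSet_Ioi fun y hy => ?_
          rw [hq, hH]
          simp only [div_eq_mul_inv]
          rw [ENNReal.mul_inv (Or.inl (scale_ne_zero a b y)) (Or.inl (scale_ne_top a b y)),
            mul_assoc, mul_assoc, ENNReal.inv_mul_cancel
              (tailIntegral_plus_ne_zero h hf (le_of_lt hy)) (hTtop y hy), mul_one]
  calc A * ∫⁻ x in Ioi θ, ENNReal.ofReal (g x ^ 2) * speed a b x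
      ≤ A * (A⁻¹ * ∫⁻ y in Ioi θ, ENNReal.ofReal (deriv g y ^ 2) / scale a b y) := by gcongr
    _ = (A * A⁻¹) * ∫⁻ y in Ioi θ, ENNReal.ofReal (deriv g y ^ 2) / scale a b y := by ring
    _ ≤ 1 * ∫⁻ y in Ioi θ, ENNReal.ofReal (deriv g y ^ 2) / scale a b y := by
        gcongr; exact ENNReal.mul_inv_le_one A
    _ = _ := one_mul _

theorem isHalfLineFun_of_mem_classI {s : Side} {f : ℝ → ℝ} (hf : f ∈ classI s θ) :
    IsHalfLineFun s θ f := ⟨hf.1, hf.2.1, hf.2.2.1⟩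

theorem classI_plus_subset_classII (θ : ℝ) : classI .plus θ ⊆ classII .plus θ := by
  intro f hf
  refine ⟨hf.1, hf.2.2.1, fun x hx => ?_⟩
  have hmono : StrictMonoOn f (Ici θ) :=
    strictMonoOn_of_deriv_pos (convex_Ici θ) hf.1 fun y hy => hf.2.2.2 y (by simpa [ray] using hy)
  have := hmono (mem_Ici.2 le_rfl) (mem_Ici.2 (le_of_lt hx)) hx
  rwa [hf.2.2.1] at this

theorem lintegral_deriv_eq_of_mem_classI {f : ℝ → ℝ} (hf : f ∈ classI .plus θ) {x : ℝ}
    (hx : θ ≤ x) : ∫⁻ y in Ioc θ x, ENNReal.ofReal (deriv f y) = ENNReal.ofReal (f x) := by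
  have hg := isHalfLineFun_of_mem_classI hf
  have hint : IntegrableOn (deriv f) (Ioc θ x) :=
    intervalIntegral.integrableOn_deriv_of_nonneg (hf.1.mono Icc_subset_Ici_self)
      (fun y hy => hg.hasDerivAt hy.1) fun y hy => (hf.2.2.2 y hy.1).le
  have hftc : ∫ y in θ..x, deriv f y = f x - f θ :=
    intervalIntegral.integral_eq_sub_of_hasDerivAt_of_le hx
      (hf.1.mono Icc_subset_Ici_self) (fun y hy => hg.hasDerivAt hy.1)
      ((intervalIntegrable_iff_integrableOn_Ioc_of_le hx).2 hint)
  rw [hf.2.2.1, sub_zero, intervalIntegral.integral_of_le hx] at hftc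
  rw [← hftc, ofReal_integral_eq_lintegral_ofReal hint]
  exact ae_restrict_of_forall_mem measurableSet_Ioc fun y hy => (hf.2.2.2 y hy.1).le

theorem varI_le_varII_plus (a b : ℝ → ℝ) (θ : ℝ) : varI a b .plus θ ≤ varII a b .plus θ := by
  refine iSup₂_le fun f hf => ?_
  have hf2 := classI_plus_subset_classII θ hf
  set A := ⨅ x ∈ ray .plus θ, (opI a b .plus f x)⁻¹ with hA
  rcases eq_or_ne A 0 with hA0 | hA0
  · rw [hA0]; exact zero_le
  have hAt : A⁻¹ ≠ ⊤ := ENNReal.inv_ne_top.2 hA0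
  have hop : ∀ y ∈ Ioi θ, ENNReal.ofReal (Real.exp (-potential a b y)) *
      tailIntegral a b .plus f y ≤ A⁻¹ * ENNReal.ofReal (deriv f y) := by
    intro y hy
    have h1 : A ≤ (opI a b .plus f y)⁻¹ := iInf₂_le y hy
    have h2 : opI a b .plus f y ≤ A⁻¹ := ENNReal.le_inv_iff_le_inv.2 h1
    have hd : 0 < deriv f y := hf.2.2.2 y hy
    have h3 := mul_le_mul_left h2 (ENNReal.ofReal (deriv f y))
    refine le_trans (le_of_eq ?_) h3
    rw [opI, mul_right_comm, ← ENNReal.ofReal_mul (by positivity), div_mul_cancel₀ _ hd.ne']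
  refine le_trans ?_ (le_iSup₂ (f := fun f (_ : f ∈ classII .plus θ) =>
    ⨅ x ∈ ray .plus θ, (opII a b .plus θ f x)⁻¹) f hf2)
  refine le_iInf₂ fun x hx => ENNReal.le_inv_iff_le_inv.1 ?_
  have hfx : 0 < f x := hf2.2.2 x hx
  rw [opII, uIoc_of_le (le_of_lt hx), abs_of_pos hfx]
  refine (ENNReal.div_le_iff (by simpa using hfx) ENNReal.ofReal_ne_top).2 ?_
  rw [← lintegral_deriv_eq_of_mem_classI hf (le_of_lt hx), ← lintegral_const_mul' _ _ hAt]
  exact setLIntegral_mono' measurableSet_Ioc fun y hy => hop y hy.1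

end Variational

section Primitive

variable {a b : ℝ → ℝ} {θ : ℝ}

theorem exists_continuous_tail {W : ℝ → ℝ≥0∞} (hW : Measurable W) (hWt : ∫⁻ x, W x ≠ ⊤) :
    ∃ τ : ℝ → ℝ, Continuous τ ∧ ∀ y, ENNReal.ofReal (τ y) = ∫⁻ z in Ioi y, W z := by
  have hint : Integrable (fun x => (W x).toReal) := integrable_toReal_of_lintegral_ne_top
    hW.aemeasurable hWt
  have hfin : ∀ᵐ x, W x < ⊤ := ae_lt_top hW hWt
  have hle : ∀ y, ∫⁻ z in Ioi y, W z ≠ ⊤ := fun y =>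
    ((setLIntegral_le_lintegral _ _).trans_lt (lt_top_iff_ne_top.2 hWt)).ne
  refine ⟨fun y => ∫ z in Ioi y, (W z).toReal, ?_, fun y => ?_⟩
  · have heq : (fun y => ∫ z in Ioi y, (W z).toReal) =
        fun y => (∫ z in Ioi 0, (W z).toReal) - ∫ z in (0 : ℝ)..y, (W z).toReal := by
      funext y
      rw [← intervalIntegral.integral_Ioi_sub_Ioi' hint.integrableOn hint.integrableOn]
      ring
    rw [heq]
    exact continuous_const.sub
      (intervalIntegral.continuous_primitive (fun _ _ => hint.intervalIntegrable) 0)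
  · beta_reduce
    rw [integral_toReal hW.aemeasurable (ae_restrict_of_ae hfin), ENNReal.ofReal_toReal (hle y)]

/-- The primitive `∫_θ^x e^{-C} τ`. -/
noncomputable def scalePrimitive (a b : ℝ → ℝ) (θ : ℝ) (τ : ℝ → ℝ) (x : ℝ) : ℝ :=
  ∫ y in θ..x, Real.exp (-potential a b y) * τ y

theorem hasDerivAt_scalePrimitive (h : Admissible a b) {τ : ℝ → ℝ} (hτ : Continuous τ) (x : ℝ) :
    HasDerivAt (scalePrimitive a b θ τ) (Real.exp (-potential a b x) * τ x) x :=
  ((h.continuous_scale.mul hτ).integral_hasStrictDerivAt θ x).hasDerivAt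

theorem contDiff_scalePrimitive (h : Admissible a b) {τ : ℝ → ℝ} (hτ : Continuous τ) :
    ContDiff ℝ 1 (scalePrimitive a b θ τ) := by
  rw [contDiff_one_iff_deriv]
  refine ⟨fun t => (hasDerivAt_scalePrimitive h hτ t).differentiableAt, ?_⟩
  rw [show deriv (scalePrimitive a b θ τ) = _ from
    funext fun t => (hasDerivAt_scalePrimitive h hτ t).deriv]
  exact h.continuous_scale.mul hτ

theorem scalePrimitive_self (a b : ℝ → ℝ) (θ : ℝ) (τ : ℝ → ℝ) : scalePrimitive a b θ τ θ = 0 :=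
  intervalIntegral.integral_same

theorem isHalfLineFun_scalePrimitive (h : Admissible a b) {τ : ℝ → ℝ} (hτ : Continuous τ)
    (s : Side) : IsHalfLineFun s θ (scalePrimitive a b θ τ) :=
  ⟨(contDiff_scalePrimitive h hτ).continuous.continuousOn,
    (contDiff_scalePrimitive h hτ).contDiffOn, scalePrimitive_self a b θ τ⟩

theorem scalePrimitive_nonneg {τ : ℝ → ℝ} (hτ0 : ∀ x, 0 ≤ τ x) {x : ℝ}
    (hx : θ ≤ x) : 0 ≤ scalePrimitive a b θ τ x :=
  intervalIntegral.integral_nonneg hx fun y _ => mul_nonneg (Real.exp_pos _).le (hτ0 y)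

theorem ofReal_scalePrimitive (h : Admissible a b) {τ : ℝ → ℝ} (hτ : Continuous τ)
    (hτ0 : ∀ x, 0 ≤ τ x) {x : ℝ} (hx : θ ≤ x) :
    ENNReal.ofReal (scalePrimitive a b θ τ x) =
      ∫⁻ y in Ioc θ x, scale a b y * ENNReal.ofReal (τ y) := by
  have hi : IntegrableOn (fun y => Real.exp (-potential a b y) * τ y) (Ioc θ x) :=
    ((h.continuous_scale.mul hτ).integrableOn_Icc).mono_set Ioc_subset_Icc_self
  rw [scalePrimitive, intervalIntegral.integral_of_le hx, ofReal_integral_eq_lintegral_ofReal hi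
    (ae_of_all _ fun y => mul_nonneg (Real.exp_pos _).le (hτ0 y))]
  exact lintegral_congr fun y => ENNReal.ofReal_mul (Real.exp_pos _).le

/-- The Poincaré inequality for functions with derivative `e^{-C} τ`. -/
theorem lambdaZero_mul_lintegral_sq_le (h : Admissible a b) {τ : ℝ → ℝ} (hτ : Continuous τ)
    (hτ0 : ∀ x, 0 ≤ τ x) :
    lambdaZero a b .plus θ * ∫⁻ x in Ioi θ,
        (∫⁻ y in Ioc θ x, scale a b y * ENNReal.ofReal (τ y)) ^ 2 * speed a b x ≤
      ∫⁻ x in Ioi θ, scale a b x * ENNReal.ofReal (τ x) ^ 2 := by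
  have := (poincare_iff_scale_speed h _ _).1
    (lambdaZero_poincare h (isHalfLineFun_scalePrimitive (θ := θ) h hτ .plus))
  convert this using 1
  · congr 1
    refine setLIntegral_congr_fun measurableSet_Ioi fun x hx => ?_
    have hx' : θ ≤ x := le_of_lt hx
    rw [ENNReal.ofReal_pow (scalePrimitive_nonneg hτ0 hx'), ofReal_scalePrimitive h hτ hτ0 hx']
  · refine lintegral_congr fun x => ?_
    rw [(hasDerivAt_scalePrimitive h hτ x).deriv, mul_pow, scale,
      ← ENNReal.ofReal_div_of_pos (Real.exp_pos _), ← ENNReal.ofReal_pow (hτ0 x),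
      ← ENNReal.ofReal_mul (Real.exp_pos _).le]
    congr 1
    have := (Real.exp_pos (-potential a b x)).ne'
    field_simp

end Primitive

section Green

variable {a b : ℝ → ℝ} {θ : ℝ}

/-- The speed measure on the half-line `(θ, ∞)`. -/
noncomputable def speedMeasure (a b : ℝ → ℝ) (θ : ℝ) : Measure ℝ :=
  (volume.restrict (Ioi θ)).withDensity (speed a b)

theorem lintegral_speedMeasure (h : Admissible a b) (g : ℝ → ℝ≥0∞) :
    ∫⁻ x, g x ∂(speedMeasure a b θ) = ∫⁻ x in Ioi θ, g x * speed a b x := by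
  rw [speedMeasure, lintegral_withDensity_eq_lintegral_mul_non_measurable _ h.measurable_speed
    (ae_of_all _ fun x => lt_top_iff_ne_top.2 (speed_ne_top a b x))]
  simp only [Pi.mul_apply, mul_comm]

/-- The `L²` norm with respect to the speed measure on the half-line. -/
noncomputable def speedNorm (a b : ℝ → ℝ) (θ : ℝ) (F : ℝ → ℝ≥0∞) : ℝ≥0∞ :=
  (∫⁻ x, F x ^ 2 ∂(speedMeasure a b θ)) ^ (1 / 2 : ℝ)

theorem speedNorm_sq (a b : ℝ → ℝ) (θ : ℝ) (F : ℝ → ℝ≥0∞) :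
    speedNorm a b θ F ^ 2 = ∫⁻ x, F x ^ 2 ∂(speedMeasure a b θ) := by
  rw [speedNorm, ← ENNReal.rpow_natCast, ← ENNReal.rpow_mul]; norm_num

theorem speedNorm_add_le {F G : ℝ → ℝ≥0∞} (hF : Measurable F) (hG : Measurable G) :
    speedNorm a b θ (fun x => F x + G x) ≤ speedNorm a b θ F + speedNorm a b θ G := by
  have := ENNReal.lintegral_Lp_add_le (μ := speedMeasure a b θ) (p := 2) hF.aemeasurable
    hG.aemeasurable one_le_two
  simpa [speedNorm, ENNReal.rpow_two] using this

theorem speedNorm_const_mul {F : ℝ → ℝ≥0∞} (hF : Measurable F) (c : ℝ≥0∞) :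
    speedNorm a b θ (fun x => c * F x) = c * speedNorm a b θ F := by
  simp only [speedNorm, mul_pow]
  rw [lintegral_const_mul _ (hF.pow_const 2), ENNReal.mul_rpow_of_nonneg _ _ (by norm_num),
    ← ENNReal.rpow_natCast c, ← ENNReal.rpow_mul]
  norm_num

theorem speedNorm_mono {F G : ℝ → ℝ≥0∞} (hFG : F ≤ G) : speedNorm a b θ F ≤ speedNorm a b θ G :=
  ENNReal.rpow_le_rpow (lintegral_mono fun x => pow_le_pow_left' (hFG x) 2) (by norm_num)

theorem speedNorm_one_ne_top (h : Admissible a b) : speedNorm a b θ (fun _ => 1) ≠ ⊤ := by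
  refine ENNReal.rpow_ne_top_of_nonneg (by norm_num) ?_
  rw [lintegral_speedMeasure h]
  simp only [one_pow, one_mul]
  exact ((setLIntegral_le_lintegral _ _).trans_lt (lt_top_iff_ne_top.2 h.lintegral_speed_ne_top)).ne

/-- The Green operator `F ↦ ∫_θ^x e^{-C(y)} ∫_y^∞ F e^C / a`. -/
noncomputable def green (a b : ℝ → ℝ) (θ : ℝ) (F : ℝ → ℝ≥0∞) (x : ℝ) : ℝ≥0∞ :=
  ∫⁻ y in Ioc θ x, scale a b y * ∫⁻ z in Ioi y, F z * speed a b z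

theorem monotone_green (a b : ℝ → ℝ) (θ : ℝ) (F : ℝ → ℝ≥0∞) : Monotone (green a b θ F) :=
  fun _ _ hxy => lintegral_mono_set (Ioc_subset_Ioc_right hxy)

theorem green_mono {F G : ℝ → ℝ≥0∞} (hFG : F ≤ G) (x : ℝ) : green a b θ F x ≤ green a b θ G x := by
  unfold green
  gcongr with y z
  exact hFG z

theorem measurable_setLIntegral_Ioi (W : ℝ → ℝ≥0∞) : Measurable fun y => ∫⁻ z in Ioi y, W z :=
  Antitone.measurable fun _ _ hxy => lintegral_mono_set (Ioi_subset_Ioi hxy)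

theorem lintegral_indicator_mul_speed_ne_top (h : Admissible a b) {F : ℝ → ℝ≥0∞} {t : Set ℝ}
    (hθ : t ⊆ Ioi θ) (hF : speedNorm a b θ F ≠ ⊤) :
    ∫⁻ z, t.indicator F z * speed a b z ≠ ⊤ := by
  have hsq : ∫⁻ x in Ioi θ, F x ^ 2 * speed a b x ≠ ⊤ := by
    rw [← lintegral_speedMeasure h, ← speedNorm_sq]
    exact ENNReal.pow_ne_top hF
  refine ne_top_of_le_ne_top (ENNReal.add_ne_top.2 ⟨h.lintegral_speed_ne_top, hsq⟩) ?_
  rw [← lintegral_indicator measurableSet_Ioi, ← lintegral_add_left h.measurable_speed]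
  refine lintegral_mono fun z => ?_
  by_cases hz : z ∈ t
  · rw [indicator_of_mem hz, indicator_of_mem (hθ hz)]
    have hle : F z ≤ 1 + F z ^ 2 := by
      rcases le_total (F z) 1 with h1 | h1
      · exact h1.trans le_self_add
      · exact (le_self_pow₀ h1 two_ne_zero).trans le_add_self
    calc F z * speed a b z ≤ (1 + F z ^ 2) * speed a b z := by gcongr
      _ = _ := by ring
  · rw [indicator_of_notMem hz, zero_mul]
    exact zero_le

/-- The Green operator is bounded by `1 / λ₀` on `L²`. -/
theorem lambdaZero_mul_speedNorm_green_le (h : Admissible a b) {F : ℝ → ℝ≥0∞} (hF : Measurable F)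
    (hFt : speedNorm a b θ F ≠ ⊤) (N : ℝ) :
    lambdaZero a b .plus θ * speedNorm a b θ (green a b θ ((Ioo θ N).indicator F)) ≤
      speedNorm a b θ F := by
  set G := (Ioo θ N).indicator F with hG
  have hGm : Measurable G := hF.indicator measurableSet_Ioo
  set k := green a b θ G with hk
  have hkm : Measurable k := (monotone_green a b θ G).measurable
  have hWm : Measurable fun z => G z * speed a b z := hGm.mul h.measurable_speed
  have hWt : ∫⁻ z, G z * speed a b z ≠ ⊤ :=
    lintegral_indicator_mul_speed_ne_top h Ioo_subset_Ioi_self hFt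
  obtain ⟨τ, hτ, hτW⟩ := exists_continuous_tail hWm hWt
  have hpoinc := lambdaZero_mul_lintegral_sq_le (θ := θ) h
    (hτ.max continuous_const) (fun x => le_max_right (τ x) 0)
  have hmax : ∀ y, ENNReal.ofReal (max (τ y) 0) = ∫⁻ z in Ioi y, G z * speed a b z := fun y => by
    rw [← hτW, ENNReal.ofReal_max, ENNReal.ofReal_zero, max_eq_left zero_le]
  simp_rw [hmax] at hpoinc
  set T : ℝ → ℝ≥0∞ := fun y => ∫⁻ z in Ioi y, G z * speed a b z with hT
  have hTm : Measurable T := measurable_setLIntegral_Ioi _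
  have hright : ∫⁻ x in Ioi θ, scale a b x * T x ^ 2 = ∫⁻ x, G x * k x ∂(speedMeasure a b θ) := by
    rw [lintegral_speedMeasure h]
    have := lintegral_Ioi_mul_lintegral_Ioc θ hWm.aemeasurable
      (h.measurable_scale.mul hTm).aemeasurable
    simp only [Pi.mul_apply] at this
    calc ∫⁻ x in Ioi θ, scale a b x * T x ^ 2 = ∫⁻ x in Ioi θ, scale a b x * T x * T x := by
          simp_rw [pow_two, mul_assoc]
      _ = _ := this.symm
      _ = _ := lintegral_congr fun x => mul_right_comm _ _ _
  have hX : speedNorm a b θ k ≠ ⊤ := by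
    have hbound : ∀ x, k x ≤ T θ * ∫⁻ t in Ioc θ N, scale a b t := by
      intro x
      have hzero : ∀ y, y ∉ Iio N → T y = 0 := by
        intro y hy
        refine (setLIntegral_congr_fun measurableSet_Ioi fun z hz => ?_).trans lintegral_zero
        have : z ∉ Ioo θ N := fun hz' => hy (lt_trans hz hz'.2)
        simp only [hG]
        rw [indicator_of_notMem this, zero_mul]
      calc k x ≤ ∫⁻ y in Ioi θ, scale a b y * T y := lintegral_mono_set fun y hy => hy.1
        _ ≤ ∫⁻ y in Ioi θ, (Ioc θ N).indicator (fun y => T θ * scale a b y) y := by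
            refine setLIntegral_mono' measurableSet_Ioi fun y hy => ?_
            by_cases hyN : y ∈ Iio N
            · rw [indicator_of_mem (show y ∈ Ioc θ N from ⟨hy, le_of_lt hyN⟩), mul_comm]
              gcongr ?_ * _
              exact lintegral_mono_set (Ioi_subset_Ioi (le_of_lt hy))
            · rw [hzero y hyN, mul_zero]; exact zero_le
        _ ≤ ∫⁻ y, (Ioc θ N).indicator (fun y => T θ * scale a b y) y :=
            setLIntegral_le_lintegral _ _
        _ = _ := by
            rw [lintegral_indicator measurableSet_Ioc, lintegral_const_mul _ h.measurable_scale]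
    have hC : T θ * ∫⁻ t in Ioc θ N, scale a b t ≠ ⊤ :=
      ENNReal.mul_ne_top (ne_top_of_le_ne_top hWt (setLIntegral_le_lintegral _ _))
        (h.lintegral_scale_ne_top θ N)
    refine ne_top_of_le_ne_top ?_ (speedNorm_mono (G := fun _ =>
      (T θ * ∫⁻ t in Ioc θ N, scale a b t) * 1) fun x => by simpa using hbound x)
    rw [speedNorm_const_mul measurable_const]
    exact ENNReal.mul_ne_top hC (speedNorm_one_ne_top h)
  have hcs : ∫⁻ x, G x * k x ∂(speedMeasure a b θ) ≤ speedNorm a b θ F * speedNorm a b θ k := by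
    have hGF : G ≤ F := indicator_le_self' fun _ _ => zero_le
    have := sq_lintegral_mul_le (speedMeasure a b θ) hGm.aemeasurable hkm.aemeasurable
    rw [← speedNorm_sq, ← speedNorm_sq, ← mul_pow] at this
    refine ((ENNReal.pow_le_pow_left_iff two_ne_zero).1 this).trans ?_
    gcongr
    exact speedNorm_mono hGF
  have hfinal : lambdaZero a b .plus θ * speedNorm a b θ k ^ 2 ≤
      speedNorm a b θ F * speedNorm a b θ k := by
    rw [speedNorm_sq, lintegral_speedMeasure h]
    exact hpoinc.trans (hright ▸ hcs)
  rcases eq_or_ne (speedNorm a b θ k) 0 with h0 | h0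
  · rw [h0, mul_zero]; exact zero_le
  rw [pow_two, ← mul_assoc] at hfinal
  exact (ENNReal.mul_le_mul_iff_left h0 hX).1 hfinal

end Green

section Converse

variable {a b : ℝ → ℝ} {θ : ℝ}

/-- The iteration `F ↦ 1 + L · green F`, with cutoffs. -/
noncomputable def greenIter (a b : ℝ → ℝ) (θ : ℝ) (L : ℝ≥0∞) : ℕ → ℝ → ℝ≥0∞
  | 0 => fun _ => 0
  | n + 1 => fun x => 1 + L * green a b θ ((Ioo θ n).indicator (greenIter a b θ L n)) x

theorem measurable_greenIter (a b : ℝ → ℝ) (θ : ℝ) (L : ℝ≥0∞) (n : ℕ) :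
    Measurable (greenIter a b θ L n) := by
  cases n with
  | zero => exact measurable_const
  | succ n => exact measurable_const.add (measurable_const.mul (monotone_green a b θ _).measurable)

theorem monotone_greenIter (a b : ℝ → ℝ) (θ : ℝ) (L : ℝ≥0∞) : Monotone (greenIter a b θ L) := by
  refine monotone_nat_of_le_succ fun n => ?_
  induction n with
  | zero => exact fun x => zero_le
  | succ n ih =>
    intro x
    simp only [greenIter]
    gcongr 1 + L * ?_
    refine green_mono (fun y => ?_) x
    refine (indicator_le_indicator_of_subset (Ioo_subset_Ioo_right ?_) (fun _ => zero_le) y).trans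
      (indicator_le_indicator (ih y))
    exact_mod_cast n.le_succ

theorem speedNorm_greenIter_le (h : Admissible a b) {L M : ℝ≥0∞} (hLM : L < M) (hM : M ≠ ⊤)
    (hMl : M ≤ lambdaZero a b .plus θ) (n : ℕ) :
    speedNorm a b θ (greenIter a b θ L n) ≤
      speedNorm a b θ (fun _ => 1) * (1 - L / M)⁻¹ := by
  have hM0 : M ≠ 0 := (zero_le.trans_lt hLM).ne'
  have hr : L / M < 1 := (ENNReal.div_lt_iff (Or.inl hM0) (Or.inl hM)).2 (by rwa [one_mul])
  have hr' : 1 - L / M ≠ 0 := (tsub_pos_of_lt hr).ne'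
  have hB : speedNorm a b θ (fun _ => 1) * (1 - L / M)⁻¹ ≠ ⊤ :=
    ENNReal.mul_ne_top (speedNorm_one_ne_top h) (ENNReal.inv_ne_top.2 hr')
  induction n with
  | zero => simp [greenIter, speedNorm]
  | succ n ih =>
    have hgm : Measurable (green a b θ ((Ioo θ n).indicator (greenIter a b θ L n))) :=
      (monotone_green a b θ _).measurable
    have hgreen : L * speedNorm a b θ (green a b θ ((Ioo θ n).indicator (greenIter a b θ L n))) ≤
        L / M * speedNorm a b θ (greenIter a b θ L n) := by
      have h1 := (mul_le_mul_left hMl _).trans (lambdaZero_mul_speedNorm_green_le (θ := θ) h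
        (measurable_greenIter a b θ L n) (ne_top_of_le_ne_top hB ih) n)
      calc L * speedNorm a b θ (green a b θ ((Ioo θ n).indicator (greenIter a b θ L n)))
          = L / M * (M * speedNorm a b θ
              (green a b θ ((Ioo θ n).indicator (greenIter a b θ L n)))) := by
            rw [← mul_assoc, ENNReal.div_mul_cancel hM0 hM]
        _ ≤ _ := by gcongr
    calc speedNorm a b θ (greenIter a b θ L (n + 1))
        ≤ speedNorm a b θ (fun _ => 1) + L * speedNorm a b θ
            (green a b θ ((Ioo θ n).indicator (greenIter a b θ L n))) := by
          rw [← speedNorm_const_mul hgm]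
          exact speedNorm_add_le measurable_const (measurable_const.mul hgm)
      _ ≤ speedNorm a b θ (fun _ => 1) +
            L / M * (speedNorm a b θ (fun _ => 1) * (1 - L / M)⁻¹) := by
          exact add_le_add le_rfl (hgreen.trans (mul_le_mul_right ih _))
      _ = (speedNorm a b θ (fun _ => 1) * (1 - L / M)⁻¹) * ((1 - L / M) + L / M) := by
          rw [mul_add, mul_assoc, ENNReal.inv_mul_cancel hr' (by simp), mul_one,
            mul_comm (L / M)]
      _ = _ := by rw [tsub_add_cancel_of_le hr.le, mul_one]

/-- A positive strict supersolution: below `λ₀` the equation `F = 1 + L · green F` has a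
finite-norm solution. -/
theorem exists_supersolution (h : Admissible a b) {L : ℝ≥0∞}
    (hL : L < lambdaZero a b .plus θ) : ∃ F : ℝ → ℝ≥0∞, Measurable F ∧ (∀ x, 1 ≤ F x) ∧
      speedNorm a b θ F ≠ ⊤ ∧ ∀ x, L * green a b θ ((Ioi θ).indicator F) x ≤ F x := by
  obtain ⟨M, hLM, hMl⟩ := exists_between hL
  have hMt : M ≠ ⊤ := hMl.ne_top
  have hM0 : M ≠ 0 := (zero_le.trans_lt hLM).ne'
  have hr : L / M < 1 := (ENNReal.div_lt_iff (Or.inl hM0) (Or.inl hMt)).2 (by rwa [one_mul])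
  have hB : speedNorm a b θ (fun _ => 1) * (1 - L / M)⁻¹ ≠ ⊤ :=
    ENNReal.mul_ne_top (speedNorm_one_ne_top h) (ENNReal.inv_ne_top.2 (tsub_pos_of_lt hr).ne')
  set G := greenIter a b θ L
  have hGm : ∀ n, Measurable (G n) := measurable_greenIter a b θ L
  have hG : Monotone G := monotone_greenIter a b θ L
  refine ⟨fun x => ⨆ n, G n x, .iSup hGm, fun x => ?_, ?_, fun x => ?_⟩
  · refine le_trans ?_ (le_iSup (fun n => G n x) 1)
    exact le_self_add
  · have hle : speedNorm a b θ (fun x => ⨆ n, G n x) ≤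
        speedNorm a b θ (fun _ => 1) * (1 - L / M)⁻¹ := by
      rw [← ENNReal.pow_le_pow_left_iff two_ne_zero, speedNorm_sq]
      simp_rw [ENNReal.iSup_pow]
      rw [lintegral_iSup (fun n => (hGm n).pow_const 2)
        fun m n hmn x => pow_le_pow_left' (hG hmn x) 2]
      refine iSup_le fun n => ?_
      rw [← speedNorm_sq]
      exact pow_le_pow_left' (speedNorm_greenIter_le h hLM hMt hMl.le n) 2
    exact ne_top_of_le_ne_top hB hle
  · have hsup : ∀ z, (Ioi θ).indicator (fun x => ⨆ n, G n x) z =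
        ⨆ n : ℕ, (Ioo θ (n : ℝ)).indicator (G n) z := by
      intro z
      by_cases hz : z ∈ Ioi θ
      · rw [indicator_of_mem hz]
        obtain ⟨N, hN⟩ := exists_nat_gt z
        refine le_antisymm (iSup_le fun n => ?_) (iSup_mono fun n => ?_)
        · refine le_trans ?_ (le_iSup _ (max n N))
          rw [indicator_of_mem]
          · exact hG (le_max_left n N) z
          · exact ⟨hz, hN.trans_le (by exact_mod_cast le_max_right n N)⟩
        · exact indicator_le_self' (fun _ _ => zero_le) z
      · rw [indicator_of_notMem hz]
        refine (le_antisymm (iSup_le fun n => ?_) zero_le).symm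
        rw [indicator_of_notMem fun hz' => hz hz'.1]
    have hIm : ∀ n : ℕ, Measurable ((Ioo θ (n : ℝ)).indicator (G n)) := fun n =>
      (hGm n).indicator measurableSet_Ioo
    have hImono : Monotone fun (n : ℕ) => (Ioo θ (n : ℝ)).indicator (G n) := fun m n hmn z =>
      (indicator_le_indicator_of_subset (Ioo_subset_Ioo_right (by exact_mod_cast hmn))
        (fun _ => zero_le) z).trans (indicator_le_indicator (hG hmn z))
    have hgreen : green a b θ ((Ioi θ).indicator fun x => ⨆ n, G n x) x =
        ⨆ n : ℕ, green a b θ ((Ioo θ (n : ℝ)).indicator (G n)) x := by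
      unfold green
      rw [← lintegral_iSup]
      · refine lintegral_congr fun y => ?_
        rw [← ENNReal.mul_iSup, ← lintegral_iSup]
        · congr 1
          refine lintegral_congr fun z => ?_
          rw [hsup, ENNReal.iSup_mul]
        · exact fun n => (hIm n).mul h.measurable_speed
        · exact fun m n hmn z => mul_le_mul_left (hImono hmn z) _
      · exact fun n => h.measurable_scale.mul (measurable_setLIntegral_Ioi _)
      · intro m n hmn y
        exact mul_le_mul_right (lintegral_mono fun z => mul_le_mul_left (hImono hmn z) _) _
    rw [hgreen, ENNReal.mul_iSup]
    refine iSup_le fun n => le_trans ?_ (le_iSup (fun n => G n x) (n + 1))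
    exact le_add_self

/-- The supersolution gives a test function attaining any value below `λ₀`. -/
theorem lambdaZero_le_varI_plus (h : Admissible a b) (θ : ℝ) :
    lambdaZero a b .plus θ ≤ varI a b .plus θ := by
  refine le_of_forall_lt_imp_le_of_dense fun L hL => ?_
  rcases eq_or_ne L 0 with rfl | hL0
  · exact zero_le
  have hLt : L ≠ ⊤ := hL.ne_top
  obtain ⟨F, hFm, hF1, hFt, hF⟩ := exists_supersolution h hL
  set W : ℝ → ℝ≥0∞ := fun z => (Ioi θ).indicator F z * speed a b z with hW
  have hWm : Measurable W := (hFm.indicator measurableSet_Ioi).mul h.measurable_speed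
  obtain ⟨τ, hτ, hτW⟩ := exists_continuous_tail hWm
    (lintegral_indicator_mul_speed_ne_top h subset_rfl hFt)
  have hτ0 : ∀ y, 0 < τ y := by
    intro y
    rw [← ENNReal.ofReal_pos, hτW, pos_iff_ne_zero]
    intro h0
    have hae := (lintegral_eq_zero_iff' hWm.aemeasurable).1 h0
    have hfalse : ∀ᵐ z ∂(volume.restrict (Ioi (max y θ))), False := by
      filter_upwards [ae_restrict_of_ae_restrict_of_subset (Ioi_subset_Ioi (le_max_left y θ)) hae,
        ae_restrict_mem measurableSet_Ioi] with z hz hz'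
      simp only [hW] at hz
      rw [indicator_of_mem (show z ∈ Ioi θ from (le_max_right y θ).trans_lt hz')] at hz
      exact mul_ne_zero (one_pos.trans_le (hF1 z)).ne' (h.speed_ne_zero z) hz
    rw [ae_iff] at hfalse
    simp at hfalse
  set l := L.toReal with hl
  have hl0 : 0 < l := ENNReal.toReal_pos hL0 hLt
  have hlL : ENNReal.ofReal l = L := ENNReal.ofReal_toReal hLt
  set f : ℝ → ℝ := fun x => l * scalePrimitive a b θ τ x with hf
  have hderiv : ∀ x, deriv f x = l * (Real.exp (-potential a b x) * τ x) := fun x =>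
    ((hasDerivAt_scalePrimitive h hτ x).const_mul l).deriv
  have hfd : ContDiff ℝ 1 f := contDiff_const.mul (contDiff_scalePrimitive h hτ)
  have hmem : f ∈ classI .plus θ := by
    refine ⟨hfd.continuous.continuousOn, hfd.contDiffOn, ?_, fun x _ => ?_⟩
    · simp [hf, scalePrimitive_self]
    · rw [hderiv]
      have := hτ0 x
      positivity
  have hfle : ∀ z ∈ Ioi θ, ENNReal.ofReal |f z| ≤ F z := by
    intro z hz
    have hz' : θ ≤ z := le_of_lt hz
    have h0 := scalePrimitive_nonneg (a := a) (b := b) (fun x => (hτ0 x).le) hz'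
    rw [abs_of_nonneg (mul_nonneg hl0.le h0), ENNReal.ofReal_mul hl0.le, hlL,
      ofReal_scalePrimitive h hτ (fun x => (hτ0 x).le) hz']
    simp_rw [hτW]
    exact hF z
  refine le_trans (le_iInf₂ fun x hx => ?_) (le_iSup₂ (f := fun f (_ : f ∈ classI .plus θ) =>
    ⨅ x ∈ ray .plus θ, (opI a b .plus f x)⁻¹) f hmem)
  rw [ENNReal.le_inv_iff_le_inv]
  have htail : tailIntegral a b .plus f x ≤ ENNReal.ofReal (τ x) := by
    rw [tailIntegral_plus, hτW]
    refine setLIntegral_mono' measurableSet_Ioi fun z hz => ?_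
    have hz' : z ∈ Ioi θ := lt_trans (show θ < x from hx) hz
    simp only [hW]
    rw [indicator_of_mem hz']
    gcongr
    exact hfle z hz'
  rw [opI, hderiv]
  refine (mul_le_mul_right htail _).trans (le_of_eq ?_)
  rw [← ENNReal.ofReal_mul (by have := hτ0 x; positivity), ← hlL, ← ENNReal.ofReal_inv_of_pos hl0]
  congr 1
  have := (hτ0 x).ne'
  have := (Real.exp_pos (-potential a b x)).ne'
  field_simp

end Converse

section Hardy

variable {a b : ℝ → ℝ} {θ : ℝ}

/-- A continuous cutoff with values in `[0, 1]`, equal to `1` on `(-∞, x]` and to `0` on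
`[x + ε, ∞)`. -/
noncomputable def cutoff (x ε t : ℝ) : ℝ := max 0 (min 1 (1 - (t - x) / ε))

theorem lambdaZero_mul_scale_mul_speed_le (h : Admissible a b) {x : ℝ} (hx : θ < x) :
    lambdaZero a b .plus θ * ((∫⁻ y in Ioc θ x, scale a b y) * ∫⁻ y in Ioi x, speed a b y) ≤ 1 := by
  set Φ := ∫⁻ y in Ioc θ x, scale a b y with hΦ
  set V := ∫⁻ y in Ioi x, speed a b y with hV
  have hε : ∀ ε > 0, lambdaZero a b .plus θ * (Φ ^ 2 * V) ≤
      ENNReal.ofReal (scalePrimitive a b θ (fun _ => 1) (x + ε)) := by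
    intro ε hε
    have hcont : Continuous (cutoff x ε) := by unfold cutoff; fun_prop
    have hle : ∀ t, cutoff x ε t ≤ 1 := fun t => max_le zero_le_one (min_le_left _ _)
    have h0 : ∀ t, 0 ≤ cutoff x ε t := fun t => le_max_left _ _
    have hone : ∀ t ≤ x, cutoff x ε t = 1 := fun t ht => by
      have : (t - x) / ε ≤ 0 := div_nonpos_of_nonpos_of_nonneg (by linarith) hε.le
      rw [cutoff, min_eq_left (by linarith), max_eq_right zero_le_one]
    have hzero : ∀ t, x + ε < t → cutoff x ε t = 0 := fun t ht => by
      have : 1 ≤ (t - x) / ε := (one_le_div hε).2 (by linarith)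
      rw [cutoff, min_eq_right (by linarith), max_eq_left (by linarith)]
    have hp := lambdaZero_mul_lintegral_sq_le (θ := θ) h hcont h0
    calc lambdaZero a b .plus θ * (Φ ^ 2 * V)
        ≤ lambdaZero a b .plus θ * ∫⁻ z in Ioi θ, (∫⁻ y in Ioc θ z,
            scale a b y * ENNReal.ofReal (cutoff x ε y)) ^ 2 * speed a b z := by
          gcongr _ * ?_
          rw [hV, ← lintegral_const_mul _ h.measurable_speed]
          refine le_trans (setLIntegral_mono' measurableSet_Ioi fun z hz => ?_)
            (lintegral_mono_set (Ioi_subset_Ioi hx.le))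
          gcongr
          calc Φ = ∫⁻ y in Ioc θ x, scale a b y * ENNReal.ofReal (cutoff x ε y) := by
                refine setLIntegral_congr_fun measurableSet_Ioc fun y hy => ?_
                simp [hone y hy.2]
            _ ≤ _ := lintegral_mono_set (Ioc_subset_Ioc_right (le_of_lt hz))
      _ ≤ _ := hp
      _ ≤ ∫⁻ z in Ioi θ, (Ioc θ (x + ε)).indicator (scale a b) z := by
          refine setLIntegral_mono' measurableSet_Ioi fun z hz => ?_
          by_cases hzx : z ≤ x + ε
          · rw [indicator_of_mem (show z ∈ Ioc θ (x + ε) from ⟨hz, hzx⟩)]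
            refine mul_le_of_le_one_right zero_le (pow_le_one₀ zero_le ?_)
            exact ENNReal.ofReal_le_one.2 (hle z)
          · rw [hzero z (not_le.1 hzx)]
            simp
      _ ≤ ∫⁻ z, (Ioc θ (x + ε)).indicator (scale a b) z := setLIntegral_le_lintegral _ _
      _ = _ := by
          rw [lintegral_indicator measurableSet_Ioc, ofReal_scalePrimitive h continuous_const
            (fun _ => zero_le_one) (by linarith)]
          simp
  have hlim : Tendsto (fun ε => ENNReal.ofReal (scalePrimitive a b θ (fun _ => 1) (x + ε)))
      (𝓝[>] 0) (𝓝 Φ) := by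
    have hc : Continuous fun ε => ENNReal.ofReal (scalePrimitive a b θ (fun _ => 1) (x + ε)) :=
      ENNReal.continuous_ofReal.comp ((contDiff_scalePrimitive h continuous_const).continuous.comp
        (continuous_const.add continuous_id))
    have h0 : ENNReal.ofReal (scalePrimitive a b θ (fun _ => 1) (x + 0)) = Φ := by
      rw [add_zero, ofReal_scalePrimitive h continuous_const (fun _ => zero_le_one) hx.le]
      simp [hΦ]
    exact (h0 ▸ hc.tendsto 0).mono_left nhdsWithin_le_nhds
  have hkey : lambdaZero a b .plus θ * (Φ ^ 2 * V) ≤ Φ :=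
    ge_of_tendsto hlim (eventually_nhdsWithin_of_forall fun ε hε' => hε ε hε')
  have hΦ0 : Φ ≠ 0 := by
    intro h0
    have hae := (lintegral_eq_zero_iff h.measurable_scale).1 h0
    have hfalse : ∀ᵐ y ∂(volume.restrict (Ioc θ x)), False := by
      filter_upwards [hae] with y hy using scale_ne_zero a b y hy
    rw [ae_iff] at hfalse
    simp [hx.not_ge] at hfalse
  refine (ENNReal.mul_le_mul_iff_right hΦ0 (h.lintegral_scale_ne_top θ x)).1 ?_
  calc Φ * (lambdaZero a b .plus θ * (Φ * V)) = lambdaZero a b .plus θ * (Φ ^ 2 * V) := by ring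
    _ ≤ Φ * 1 := by rwa [mul_one]

theorem hardyDelta_plus (a b : ℝ → ℝ) (θ : ℝ) : hardyDelta a b .plus θ =
    ⨆ x ∈ Ioi θ, (∫⁻ y in Ioc θ x, scale a b y) * ∫⁻ y in Ioi x, speed a b y := by
  unfold hardyDelta
  refine iSup_congr fun x => iSup_congr fun hx => ?_
  rw [uIoc_of_le (le_of_lt hx)]
  rfl

/-- The upper Hardy bound. -/
theorem lambdaZero_le_inv_hardyDelta_plus (h : Admissible a b) (θ : ℝ) :
    lambdaZero a b .plus θ ≤ (hardyDelta a b .plus θ)⁻¹ := by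
  rw [ENNReal.le_inv_iff_mul_le, hardyDelta_plus]
  simp_rw [ENNReal.mul_iSup]
  exact iSup₂_le fun x hx => lambdaZero_mul_scale_mul_speed_le h hx

theorem exists_hasDerivAt_speed_tail (h : Admissible a b) : ∃ V : ℝ → ℝ,
    (∀ x, HasDerivAt V (-speedDensity a b x) x) ∧ Tendsto V atTop (𝓝 0) ∧ (∀ x, 0 < V x) ∧
      ∀ x, ENNReal.ofReal (V x) = ∫⁻ y in Ioi x, speed a b y := by
  have hV : ∀ x, ∫ y in Ioi x, speedDensity a b y =
      (∫ y in Ioi 0, speedDensity a b y) - ∫ y in (0 : ℝ)..x, speedDensity a b y := fun x => by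
    rw [← intervalIntegral.integral_Ioi_sub_Ioi' h.integrable.integrableOn
      h.integrable.integrableOn]
    ring
  refine ⟨fun x => ∫ y in Ioi x, speedDensity a b y, fun x => ?_, ?_, fun x => ?_, fun x => ?_⟩
  · rw [funext hV]
    exact ((h.continuous_speedDensity.integral_hasStrictDerivAt 0 x).hasDerivAt).const_sub _
  · rw [funext hV]
    have := intervalIntegral_tendsto_integral_Ioi 0 h.integrable.integrableOn tendsto_id
    simpa using this.const_sub (∫ y in Ioi 0, speedDensity a b y)
  · rw [setIntegral_pos_iff_support_of_nonneg_ae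
      (ae_of_all _ fun y => (h.speedDensity_pos y).le) h.integrable.integrableOn]
    have : Function.support (speedDensity a b) = univ :=
      eq_univ_of_forall fun x => (h.speedDensity_pos x).ne'
    simp [this]
  · exact ofReal_integral_eq_lintegral_ofReal h.integrable.integrableOn
      (ae_of_all _ fun y => (h.speedDensity_pos y).le)

/-- The lower Hardy bound, by the single-integral operator at the square root of the scale
function. -/
theorem inv_four_mul_hardyDelta_le_varI_plus (h : Admissible a b) (θ : ℝ) :
    (4 * hardyDelta a b .plus θ)⁻¹ ≤ varI a b .plus θ := by
  rcases eq_or_ne (hardyDelta a b .plus θ) ⊤ with hδ | hδ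
  · simp [hδ]
  obtain ⟨V, hVd, hV0, hVpos, hV⟩ := exists_hasDerivAt_speed_tail h
  set φ := scalePrimitive a b θ (fun _ => 1) with hφ
  have hφd : ∀ x, HasDerivAt φ (Real.exp (-potential a b x)) x := fun x => by
    simpa using hasDerivAt_scalePrimitive (θ := θ) h (continuous_const (y := (1 : ℝ))) x
  have hφc : ContDiff ℝ 1 φ := contDiff_scalePrimitive h continuous_const
  have hφpos : ∀ x ∈ Ioi θ, 0 < φ x := fun x hx =>
    intervalIntegral.intervalIntegral_pos_of_pos
      ((h.continuous_scale.mul continuous_const).intervalIntegrable _ _)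
      (fun y => by simpa using Real.exp_pos _) hx
  set d := (hardyDelta a b .plus θ).toReal with hd
  have hφV : ∀ x ∈ Ioi θ, φ x * V x ≤ d := by
    intro x hx
    rw [← ENNReal.ofReal_le_iff_le_toReal hδ, ENNReal.ofReal_mul (hφpos x hx).le, hV, hφ,
      ofReal_scalePrimitive h continuous_const (fun _ => zero_le_one) (le_of_lt hx)]
    simp only [ENNReal.ofReal_one, mul_one]
    rw [hardyDelta_plus]
    exact le_iSup₂ (f := fun x (_ : x ∈ Ioi θ) =>
      (∫⁻ y in Ioc θ x, scale a b y) * ∫⁻ y in Ioi x, speed a b y) x hx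
  have hd0 : 0 ≤ d := ENNReal.toReal_nonneg
  have hsqrtV : ∀ x, HasDerivAt (fun x => -2 * √(V x)) (speedDensity a b x / √(V x)) x := by
    intro x
    have := ((hVd x).sqrt (hVpos x).ne').const_mul (-2)
    refine this.congr_deriv ?_
    have := (Real.sqrt_pos.2 (hVpos x)).ne'
    field_simp
  have hlim : Tendsto (fun x => -2 * √(V x)) atTop (𝓝 0) := by
    simpa using (hV0.sqrt).const_mul (-2)
  have hint : ∀ x, ∫⁻ y in Ioi x, ENNReal.ofReal (speedDensity a b y / √(V y)) =
      ENNReal.ofReal (2 * √(V x)) := by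
    intro x
    have hnn : ∀ y, 0 ≤ speedDensity a b y / √(V y) := fun y =>
      div_nonneg (h.speedDensity_pos y).le (Real.sqrt_nonneg _)
    have hcw := (hsqrtV x).continuousAt.continuousWithinAt (s := Ici x)
    rw [← ofReal_integral_eq_lintegral_ofReal
      (integrableOn_Ioi_deriv_of_nonneg hcw (fun y _ => hsqrtV y) (fun y _ => hnn y) hlim)
      (ae_of_all _ hnn),
      integral_Ioi_of_hasDerivAt_of_nonneg hcw (fun y _ => hsqrtV y) (fun y _ => hnn y) hlim]
    congr 1; ring
  have hsqrtφ : ∀ x ∈ Ioi θ, √(φ x) ≤ √d / √(V x) := by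
    intro x hx
    rw [le_div_iff₀ (Real.sqrt_pos.2 (hVpos x)), ← Real.sqrt_mul (hφpos x hx).le]
    exact Real.sqrt_le_sqrt (hφV x hx)
  set f : ℝ → ℝ := fun x => √(φ x) with hf
  have hfd : ∀ x ∈ Ioi θ, HasDerivAt f (Real.exp (-potential a b x) / (2 * √(φ x))) x :=
    fun x hx => (hφd x).sqrt (hφpos x hx).ne'
  have hmem : f ∈ classI .plus θ := by
    refine ⟨(Real.continuous_sqrt.comp hφc.continuous).continuousOn, ?_, ?_, fun x hx => ?_⟩
    · exact hφc.contDiffOn.sqrt fun x hx => (hφpos x hx).ne'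
    · simp [hf, hφ, scalePrimitive_self]
    · rw [(hfd x hx).deriv]
      have := Real.sqrt_pos.2 (hφpos x hx)
      have := Real.exp_pos (-potential a b x)
      positivity
  refine le_trans (le_iInf₂ fun x hx => ?_) (le_iSup₂ (f := fun f (_ : f ∈ classI .plus θ) =>
    ⨅ x ∈ ray .plus θ, (opI a b .plus f x)⁻¹) f hmem)
  rw [ENNReal.inv_le_inv]
  have hx' : x ∈ Ioi θ := hx
  have htail : tailIntegral a b .plus f x ≤ ENNReal.ofReal (√d * (2 * √(V x))) := by
    rw [ENNReal.ofReal_mul (Real.sqrt_nonneg _), ← hint,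
      ← lintegral_const_mul' _ _ ENNReal.ofReal_ne_top]
    refine setLIntegral_mono' measurableSet_Ioi fun y hy => ?_
    rw [← ENNReal.ofReal_mul (Real.sqrt_nonneg _)]
    refine ENNReal.ofReal_le_ofReal ?_
    rw [abs_of_nonneg (Real.sqrt_nonneg _), mul_div_left_comm, mul_comm]
    exact mul_le_mul_of_nonneg_left (hsqrtφ y (lt_trans (mem_Ioi.1 hx') hy)) (h.speedDensity_pos y).le
  have hs : 0 < √(φ x) := Real.sqrt_pos.2 (hφpos x hx')
  have he := Real.exp_pos (-potential a b x)
  rw [opI, (hfd x hx').deriv]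
  calc _ ≤ ENNReal.ofReal (Real.exp (-potential a b x) /
        (Real.exp (-potential a b x) / (2 * √(φ x)))) * ENNReal.ofReal (√d * (2 * √(V x))) := by
        gcongr
    _ = ENNReal.ofReal (4 * (√d * √(φ x * V x))) := by
        rw [← ENNReal.ofReal_mul (by positivity), Real.sqrt_mul (hφpos x hx').le]
        congr 1
        field_simp
        ring
    _ ≤ ENNReal.ofReal (4 * d) := by
        refine ENNReal.ofReal_le_ofReal ?_
        have h1 : √d * √(φ x * V x) ≤ √d * √d :=
          mul_le_mul_of_nonneg_left (Real.sqrt_le_sqrt (hφV x hx')) (Real.sqrt_nonneg _)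
        rw [Real.mul_self_sqrt hd0] at h1
        linarith
    _ = 4 * hardyDelta a b .plus θ := by
        rw [ENNReal.ofReal_mul (by norm_num), ENNReal.ofReal_toReal hδ, ENNReal.ofReal_ofNat]

end Hardy

section Continuity

variable {a b : ℝ → ℝ}

theorem monotone_lambdaZero_plus (h : Admissible a b) : Monotone (lambdaZero a b .plus) := by
  intro θ₁ θ₂ hθ
  refine (le_lambdaZero_iff h).2 fun g hg => (le_lambdaZero_iff h).1 le_rfl g ?_
  obtain ⟨θ', hθ', hz⟩ := hg.eq_zero
  exact ⟨hg.contDiff, hg.bounded, θ', lt_of_le_of_lt hθ hθ', hz⟩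

theorem le_lambdaZero_plus_of_forall_gt (h : Admissible a b) {L : ℝ≥0∞} {θ : ℝ}
    (hL : ∀ θ' > θ, L ≤ lambdaZero a b .plus θ') : L ≤ lambdaZero a b .plus θ := by
  refine (le_lambdaZero_iff h).2 fun g hg => ?_
  obtain ⟨θ', hθ', hz⟩ := hg.eq_zero
  have hθ'' : θ < θ' := hθ'
  exact (le_lambdaZero_iff h).1 (hL ((θ + θ') / 2) (by linarith)) g
    ⟨hg.contDiff, hg.bounded, θ', (by simp only [ray, mem_Ioi]; linarith), hz⟩

theorem sq_le_add_mul_sq {t : ℝ} (ht : 0 < t) (x c : ℝ) :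
    x ^ 2 ≤ (1 + t) * (x - c) ^ 2 + (1 + t⁻¹) * c ^ 2 := by
  have h1 : 0 ≤ t⁻¹ * (t * (x - c) - c) ^ 2 := by positivity
  have h2 : t⁻¹ * (t * (x - c) - c) ^ 2 = t * (x - c) ^ 2 - 2 * (x - c) * c + t⁻¹ * c ^ 2 := by
    field_simp
    ring
  nlinarith

/-- Moving the end point from `θ` to the left changes the Poincaré constant by little. -/
theorem lintegral_sq_mul_speed_le_of_lt (h : Admissible a b) {θ' θ : ℝ} (hθ : θ' < θ) {L : ℝ≥0∞}
    (hL0 : L ≠ 0) (hLt : L ≠ ⊤) (hL : L ≤ lambdaZero a b .plus θ) {t : ℝ} (ht : 0 < t) {g : ℝ → ℝ}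
    (hg : IsHalfLineFun .plus θ' g) :
    ∫⁻ x in Ioi θ', ENNReal.ofReal (g x ^ 2) * speed a b x ≤
      (ENNReal.ofReal (1 + t) / L + (1 + ENNReal.ofReal (1 + t⁻¹)) *
        (∫⁻ x, speed a b x) * ∫⁻ y in Ioc θ' θ, scale a b y) *
        ∫⁻ x in Ioi θ', ENNReal.ofReal (deriv g x ^ 2) / scale a b x := by
  set D := ∫⁻ x in Ioi θ', ENNReal.ofReal (deriv g x ^ 2) / scale a b x with hD
  set κ := ∫⁻ y in Ioc θ' θ, scale a b y with hκ
  set m := ∫⁻ x, speed a b x with hm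
  have hpt : ∀ x ∈ Ioc θ' θ, ENNReal.ofReal (g x ^ 2) ≤ D * κ := by
    intro x hx
    refine (hg.ofReal_sq_le hx.1.le h.measurable_scale (fun y _ => scale_ne_zero a b y)
      fun y _ => scale_ne_top a b y).trans ?_
    exact mul_le_mul' (lintegral_mono_set fun y hy => hy.1)
      (lintegral_mono_set (Ioc_subset_Ioc_right hx.2))
  have hleft : ∫⁻ x in Ioc θ' θ, ENNReal.ofReal (g x ^ 2) * speed a b x ≤ D * κ * m := by
    calc _ ≤ ∫⁻ x in Ioc θ' θ, D * κ * speed a b x :=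
          setLIntegral_mono' measurableSet_Ioc fun x hx => by gcongr; exact hpt x hx
      _ = D * κ * ∫⁻ x in Ioc θ' θ, speed a b x := lintegral_const_mul _ h.measurable_speed
      _ ≤ D * κ * m := by gcongr; exact setLIntegral_le_lintegral _ _
  have hshift : ∫⁻ x in Ioi θ, ENNReal.ofReal ((g x - g θ) ^ 2) * speed a b x ≤ D / L := by
    have hsub : IsHalfLineFun .plus θ fun x => g x - g θ :=
      ⟨(hg.continuousOn.mono (Ici_subset_Ici.2 hθ.le)).sub continuousOn_const,
        (hg.contDiffOn.mono (Ioi_subset_Ioi hθ.le)).sub contDiffOn_const, sub_self _⟩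
    have hp := (poincare_iff_scale_speed h _ _).1 (lambdaZero_poincare h hsub)
    simp_rw [deriv_sub_const] at hp
    rw [ENNReal.le_div_iff_mul_le (Or.inl hL0) (Or.inl hLt), mul_comm]
    exact (mul_le_mul_left hL _).trans (hp.trans (lintegral_mono_set (Ioi_subset_Ioi hθ.le)))
  have hmeas : AEMeasurable (fun x => ENNReal.ofReal ((g x - g θ) ^ 2) * speed a b x)
      (volume.restrict (Ioi θ)) := by
    have hc : ContinuousOn (fun x => ENNReal.ofReal ((g x - g θ) ^ 2)) (Ioi θ) :=
      ENNReal.continuous_ofReal.comp_continuousOn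
        (((hg.continuousOn.mono fun x hx => (hθ.trans hx).le).sub continuousOn_const).pow 2)
    exact (hc.aemeasurable measurableSet_Ioi).mul h.measurable_speed.aemeasurable
  have hright : ∫⁻ x in Ioi θ, ENNReal.ofReal (g x ^ 2) * speed a b x ≤
      ENNReal.ofReal (1 + t) * (D / L) + ENNReal.ofReal (1 + t⁻¹) * (D * κ * m) := by
    calc ∫⁻ x in Ioi θ, ENNReal.ofReal (g x ^ 2) * speed a b x
        ≤ ∫⁻ x in Ioi θ, (ENNReal.ofReal (1 + t) *
            (ENNReal.ofReal ((g x - g θ) ^ 2) * speed a b x) +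
            ENNReal.ofReal (1 + t⁻¹) * (D * κ) * speed a b x) := by
          refine lintegral_mono fun x => ?_
          have h1 : ENNReal.ofReal (g x ^ 2) ≤ ENNReal.ofReal (1 + t) *
              ENNReal.ofReal ((g x - g θ) ^ 2) + ENNReal.ofReal (1 + t⁻¹) * (D * κ) := by
            refine (ENNReal.ofReal_le_ofReal (sq_le_add_mul_sq ht (g x) (g θ))).trans ?_
            rw [ENNReal.ofReal_add (by positivity) (by positivity),
              ENNReal.ofReal_mul (by positivity), ENNReal.ofReal_mul (by positivity)]
            gcongr
            exact hpt θ ⟨hθ, le_rfl⟩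
          refine (mul_le_mul_left h1 _).trans (le_of_eq ?_)
          ring
      _ = ENNReal.ofReal (1 + t) *
            (∫⁻ x in Ioi θ, ENNReal.ofReal ((g x - g θ) ^ 2) * speed a b x) +
            ENNReal.ofReal (1 + t⁻¹) * (D * κ) * ∫⁻ x in Ioi θ, speed a b x := by
          rw [lintegral_add_left' (hmeas.const_mul _), lintegral_const_mul'' _ hmeas,
            lintegral_const_mul _ h.measurable_speed]
      _ ≤ ENNReal.ofReal (1 + t) * (D / L) + ENNReal.ofReal (1 + t⁻¹) * (D * κ) * m := by
          gcongr
          exact setLIntegral_le_lintegral _ _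
      _ = _ := by ring
  rw [← Ioc_union_Ioi_eq_Ioi hθ.le,
    lintegral_union measurableSet_Ioi (Ioc_disjoint_Ioi le_rfl)]
  calc _ ≤ D * κ * m + (ENNReal.ofReal (1 + t) * (D / L) +
        ENNReal.ofReal (1 + t⁻¹) * (D * κ * m)) := add_le_add hleft hright
    _ = _ := by simp only [div_eq_mul_inv]; ring

theorem tendsto_lintegral_scale_Ioc (h : Admissible a b) (θ : ℝ) :
    Tendsto (fun θ' => ∫⁻ y in Ioc θ' θ, scale a b y) (𝓝[<] θ) (𝓝 0) := by
  have hc : Continuous fun θ' => ENNReal.ofReal (-scalePrimitive a b θ (fun _ => 1) θ') :=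
    ENNReal.continuous_ofReal.comp (contDiff_scalePrimitive h continuous_const).continuous.neg
  have h0 := hc.tendsto θ
  rw [scalePrimitive_self, neg_zero, ENNReal.ofReal_zero] at h0
  refine (h0.mono_left nhdsWithin_le_nhds).congr' ?_
  filter_upwards [self_mem_nhdsWithin] with θ' hθ'
  have hθ'' : θ' ≤ θ := le_of_lt hθ'
  rw [scalePrimitive, intervalIntegral.integral_symm, neg_neg]
  have := ofReal_scalePrimitive (θ := θ') h (continuous_const (y := (1 : ℝ)))
    (fun _ => zero_le_one) hθ''
  rw [scalePrimitive] at this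
  rw [this]
  simp

theorem exists_lt_le_lambdaZero_plus (h : Admissible a b) {θ : ℝ} {M : ℝ≥0∞}
    (hM : M < lambdaZero a b .plus θ) : ∃ θ' < θ, M ≤ lambdaZero a b .plus θ' := by
  obtain ⟨L, hML, hL⟩ := exists_between hM
  have hL0 : L ≠ 0 := (zero_le.trans_lt hML).ne'
  have hMt : M ≠ ⊤ := hML.ne_top
  have hr : M / L < 1 := (ENNReal.div_lt_iff (Or.inl hL0) (Or.inl hL.ne_top)).2 (by rwa [one_mul])
  have hlim : Tendsto (fun t : ℝ => M / L * ENNReal.ofReal (1 + t)) (𝓝[>] 0) (𝓝 (M / L)) := by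
    have hc : Continuous fun t : ℝ => ENNReal.ofReal (1 + t) :=
      ENNReal.continuous_ofReal.comp (continuous_const.add continuous_id)
    have h0 := ENNReal.Tendsto.const_mul (a := M / L) (hc.tendsto 0) (Or.inr hr.ne_top)
    simp only [add_zero, ENNReal.ofReal_one, mul_one] at h0
    exact h0.mono_left nhdsWithin_le_nhds
  obtain ⟨t, htr, ht⟩ := ((hlim.eventually_lt_const hr).and self_mem_nhdsWithin).exists
  have ht0 : 0 < t := ht
  set c := M * ((1 + ENNReal.ofReal (1 + t⁻¹)) * ∫⁻ x, speed a b x) with hc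
  have hct : c ≠ ⊤ := ENNReal.mul_ne_top hMt (ENNReal.mul_ne_top
    (ENNReal.add_ne_top.2 ⟨ENNReal.one_ne_top, ENNReal.ofReal_ne_top⟩) h.lintegral_speed_ne_top)
  have hlim2 : Tendsto (fun θ' => M / L * ENNReal.ofReal (1 + t) +
      c * ∫⁻ y in Ioc θ' θ, scale a b y) (𝓝[<] θ) (𝓝 (M / L * ENNReal.ofReal (1 + t))) := by
    simpa using (ENNReal.Tendsto.const_mul (tendsto_lintegral_scale_Ioc h θ)
      (Or.inr hct)).const_add (M / L * ENNReal.ofReal (1 + t))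
  obtain ⟨θ', hlt, hθ'⟩ := ((hlim2.eventually_lt_const htr).and self_mem_nhdsWithin).exists
  refine ⟨θ', hθ', le_lambdaZero_of_poincare h fun g hg => (poincare_iff_scale_speed h _ _).2 ?_⟩
  refine (mul_le_mul_right (lintegral_sq_mul_speed_le_of_lt h hθ' hL0 hL.ne_top hL.le ht0 hg)
    M).trans ?_
  rw [← mul_assoc]
  refine mul_le_of_le_one_left zero_le (le_trans (le_of_eq ?_) hlt.le)
  rw [hc]
  simp only [div_eq_mul_inv]
  ring

theorem continuous_lambdaZero_plus (h : Admissible a b) : Continuous (lambdaZero a b .plus) := by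
  have hmono := monotone_lambdaZero_plus h
  refine continuous_iff_continuousAt.2 fun θ => continuousAt_iff_continuous_left'_right'.2 ⟨?_, ?_⟩
  · have hlim := hmono.tendsto_nhdsLT θ
    suffices heq : sSup (lambdaZero a b .plus '' Iio θ) = lambdaZero a b .plus θ by
      rwa [heq] at hlim
    refine le_antisymm (sSup_le ?_) (le_of_forall_lt_imp_le_of_dense fun M hM => ?_)
    · rintro _ ⟨x, hx, rfl⟩
      exact hmono (le_of_lt hx)
    · obtain ⟨θ', hθ', hM'⟩ := exists_lt_le_lambdaZero_plus h hM
      exact hM'.trans (le_sSup ⟨θ', hθ', rfl⟩)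
  · have hlim := hmono.tendsto_nhdsGT θ
    suffices heq : sInf (lambdaZero a b .plus '' Ioi θ) = lambdaZero a b .plus θ by
      rwa [heq] at hlim
    refine le_antisymm (le_lambdaZero_plus_of_forall_gt h fun θ' hθ' => sInf_le ⟨θ', hθ', rfl⟩)
      (le_sInf ?_)
    rintro _ ⟨x, hx, rfl⟩
    exact hmono (le_of_lt hx)

end Continuity

section Reflection

/-- The opposite side. -/
def Side.flip : Side → Side
  | .plus => .minus
  | .minus => .plus

/-- The diffusion coefficient of the reflected operator. -/
def reflectA (a : ℝ → ℝ) (x : ℝ) : ℝ := a (-x)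

/-- The drift of the reflected operator. -/
def reflectB (b : ℝ → ℝ) (x : ℝ) : ℝ := -b (-x)

variable {a b : ℝ → ℝ} {s : Side} {θ : ℝ}

theorem reflectA_reflectA (a : ℝ → ℝ) : reflectA (reflectA a) = a := by
  funext x; simp [reflectA]

theorem reflectB_reflectB (b : ℝ → ℝ) : reflectB (reflectB b) = b := by
  funext x; simp [reflectB]

theorem Side.flip_flip (s : Side) : s.flip.flip = s := by cases s <;> rfl

theorem mem_ray_flip {x : ℝ} : x ∈ ray s.flip (-θ) ↔ -x ∈ ray s θ := by
  cases s
  · simp [Side.flip, ray, lt_neg]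
  · simp [Side.flip, ray, neg_lt]

theorem mem_closedRay_flip {x : ℝ} : x ∈ closedRay s.flip (-θ) ↔ -x ∈ closedRay s θ := by
  cases s
  · simp [Side.flip, closedRay, le_neg]
  · simp [Side.flip, closedRay, neg_le]

theorem potential_reflect (a b : ℝ → ℝ) (x : ℝ) :
    potential (reflectA a) (reflectB b) x = potential a b (-x) := by
  have h1 : ∀ t, reflectB b t / reflectA a t = -(fun t => b t / a t) (-t) := fun t => by
    simp [reflectA, reflectB, neg_div]
  unfold potential
  simp_rw [h1]
  rw [intervalIntegral.integral_neg, intervalIntegral.integral_comp_neg (fun t => b t / a t),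
    neg_zero, intervalIntegral.integral_symm, neg_neg]

theorem speedDensity_reflect (a b : ℝ → ℝ) (x : ℝ) :
    speedDensity (reflectA a) (reflectB b) x = speedDensity a b (-x) := by
  simp [speedDensity, potential_reflect, reflectA]

theorem normConst_reflect (a b : ℝ → ℝ) :
    normConst (reflectA a) (reflectB b) = normConst a b := by
  simp only [normConst, speedDensity_reflect]
  exact integral_neg_eq_self (speedDensity a b) volume

theorem Admissible.reflect (h : Admissible a b) : Admissible (reflectA a) (reflectB b) where
  continuous_a := h.continuous_a.comp continuous_neg
  a_pos x := h.a_pos (-x)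
  locallyIntegrable := by
    have h1 : (fun x => reflectB b x / reflectA a x) =
        fun x => -((fun x => b x / a x) ∘ Homeomorph.neg ℝ) x := by
      funext x; simp [reflectA, reflectB, neg_div]
    rw [h1]
    refine LocallyIntegrable.neg ?_
    rw [← locallyIntegrable_map_homeomorph]
    have : Measure.map (Homeomorph.neg ℝ) (volume : Measure ℝ) = volume :=
      Measure.map_neg_eq_self volume
    rw [this]
    exact h.locallyIntegrable
  integrable := by
    have : speedDensity (reflectA a) (reflectB b) = fun x => speedDensity a b (-x) :=
      funext (speedDensity_reflect a b)
    rw [this]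
    exact h.integrable.comp_neg

theorem measurableEmbedding_neg : MeasurableEmbedding (Neg.neg : ℝ → ℝ) :=
  (MeasurableEquiv.neg ℝ).measurableEmbedding

theorem setLIntegral_preimage_neg (f : ℝ → ℝ≥0∞) (t : Set ℝ) :
    ∫⁻ x in Neg.neg ⁻¹' t, f (-x) = ∫⁻ x in t, f x :=
  (Measure.measurePreserving_neg (volume : Measure ℝ)).setLIntegral_comp_preimage_emb
    measurableEmbedding_neg f t

theorem setLIntegral_ray_flip (f : ℝ → ℝ≥0∞) (s : Side) (x : ℝ) :
    ∫⁻ y in ray s.flip (-x), f (-y) = ∫⁻ y in ray s x, f y := by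
  rw [← setLIntegral_preimage_neg f]
  congr 2
  ext y
  exact mem_ray_flip

theorem setLIntegral_uIoc_neg (f : ℝ → ℝ≥0∞) (x y : ℝ) :
    ∫⁻ t in uIoc (-x) (-y), f (-t) = ∫⁻ t in uIoc x y, f t := by
  rw [← setLIntegral_preimage_neg f]
  refine setLIntegral_congr ?_
  have hpre : Neg.neg ⁻¹' uIoc x y = Ico (min (-x) (-y)) (max (-x) (-y)) := by
    ext t
    simp only [uIoc, mem_preimage, mem_Ioc, mem_Ico, max_neg_neg, min_neg_neg]
    constructor
    · rintro ⟨h1, h2⟩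
      exact ⟨by linarith, by linarith⟩
    · rintro ⟨h1, h2⟩
      exact ⟨by linarith, by linarith⟩
  rw [hpre]
  exact Ico_ae_eq_Ioc.symm

theorem invMeasure_reflect (a b : ℝ → ℝ) :
    invMeasure (reflectA a) (reflectB b) = (invMeasure a b).map Neg.neg := by
  ext t ht
  rw [Measure.map_apply measurable_neg ht, invMeasure, invMeasure, withDensity_apply _ ht,
    withDensity_apply _ (measurable_neg ht), normConst_reflect]
  simp_rw [speedDensity_reflect]
  rw [← setLIntegral_preimage_neg]
  simp

theorem integral_invMeasure_reflect (a b f : ℝ → ℝ) :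
    ∫ x, f (-x) ∂(invMeasure (reflectA a) (reflectB b)) = ∫ x, f x ∂(invMeasure a b) := by
  rw [invMeasure_reflect, measurableEmbedding_neg.integral_map]
  simp

theorem energy_reflect (a b f : ℝ → ℝ) :
    (energy (reflectA a) (reflectB b) fun x => f (-x)) = energy a b f := by
  rw [energy, invMeasure_reflect, measurableEmbedding_neg.lintegral_map]
  simp [deriv_comp_neg, reflectA, energy]

theorem lambdaZero_reflect_le (a b : ℝ → ℝ) (s : Side) (θ : ℝ) :
    lambdaZero (reflectA a) (reflectB b) s.flip (-θ) ≤ lambdaZero a b s θ := by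
  refine le_sInf ?_
  rintro _ ⟨f, hf0, hfc, hfd, hf1, rfl⟩
  refine sInf_le ⟨fun x => f (-x), fun x hx => hf0 _ (mt mem_ray_flip.2 hx),
    hfc.comp continuous_neg.continuousOn fun x hx => mem_closedRay_flip.1 hx,
    hfd.comp contDiff_neg.contDiffOn fun x hx => mem_ray_flip.1 hx, ?_, (energy_reflect a b f).symm⟩
  exact (integral_invMeasure_reflect a b fun x => f x ^ 2).trans hf1

theorem tailIntegral_reflect (a b : ℝ → ℝ) (s : Side) {f g : ℝ → ℝ} (hfg : ∀ x, |g x| = |f (-x)|)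
    (x : ℝ) : tailIntegral (reflectA a) (reflectB b) s.flip g (-x) = tailIntegral a b s f x := by
  simp only [tailIntegral, speedDensity_reflect, hfg]
  exact setLIntegral_ray_flip (fun y => ENNReal.ofReal (|f y| * speedDensity a b y)) s x

theorem hardyDelta_le_reflect (a b : ℝ → ℝ) (s : Side) (θ : ℝ) :
    hardyDelta a b s θ ≤ hardyDelta (reflectA a) (reflectB b) s.flip (-θ) := by
  refine iSup₂_le fun x hx => ?_
  refine le_trans (le_of_eq ?_) (le_iSup₂ (-x) (mem_ray_flip.2 (by rwa [neg_neg])))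
  simp only [potential_reflect, speedDensity_reflect]
  rw [setLIntegral_uIoc_neg (fun y => ENNReal.ofReal (Real.exp (-potential a b y))),
    setLIntegral_ray_flip (fun y => ENNReal.ofReal (speedDensity a b y))]

theorem varI_le_reflect (a b : ℝ → ℝ) (s : Side) (θ : ℝ) :
    varI a b s θ ≤ varI (reflectA a) (reflectB b) s.flip (-θ) := by
  refine iSup₂_le fun f hf => ?_
  have hd : ∀ x, deriv (fun x => -f (-x)) x = deriv f (-x) := fun x => by
    rw [deriv.fun_neg, deriv_comp_neg, neg_neg]
  have hmem : (fun x => -f (-x)) ∈ classI s.flip (-θ) := by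
    refine ⟨(hf.1.comp continuous_neg.continuousOn fun x hx => mem_closedRay_flip.1 hx).neg,
      (hf.2.1.comp contDiff_neg.contDiffOn fun x hx => mem_ray_flip.1 hx).neg, ?_, fun x hx => ?_⟩
    · simp [hf.2.2.1]
    · rw [hd]
      exact hf.2.2.2 _ (mem_ray_flip.1 hx)
  refine le_iSup₂_of_le _ hmem (le_iInf₂ fun x hx => ?_)
  refine (iInf₂_le (-x) (mem_ray_flip.1 hx)).trans (le_of_eq ?_)
  have htail := tailIntegral_reflect a b s (f := f) (g := fun x => -f (-x))
    (fun x => abs_neg _) (-x)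
  rw [neg_neg] at htail
  rw [opI, opI, hd, potential_reflect, htail]

theorem varII_le_reflect (a b : ℝ → ℝ) (s : Side) (θ : ℝ) :
    varII a b s θ ≤ varII (reflectA a) (reflectB b) s.flip (-θ) := by
  refine iSup₂_le fun f hf => ?_
  have hmem : (fun x => -f (-x)) ∈ classII s.flip (-θ) := by
    cases s
    · refine ⟨(hf.1.comp continuous_neg.continuousOn
        fun x hx => mem_closedRay_flip (s := .plus).1 hx).neg, by simp [hf.2.1], fun x hx => ?_⟩
      simpa using hf.2.2 _ (mem_ray_flip (s := .plus).1 hx)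
    · refine ⟨(hf.1.comp continuous_neg.continuousOn
        fun x hx => mem_closedRay_flip (s := .minus).1 hx).neg, by simp [hf.2.1], fun x hx => ?_⟩
      exact hf.2.2 _ (mem_ray_flip (s := .minus).1 hx)
  refine le_iSup₂_of_le _ hmem (le_iInf₂ fun x hx => ?_)
  refine (iInf₂_le (-x) (mem_ray_flip.1 hx)).trans (le_of_eq ?_)
  have htail : ∀ y, tailIntegral (reflectA a) (reflectB b) s.flip (fun x => -f (-x)) y =
      tailIntegral a b s f (-y) := fun y => by
    rw [← tailIntegral_reflect a b s (f := f) (g := fun x => -f (-x)) (fun x => abs_neg _) (-y),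
      neg_neg]
  have hint := setLIntegral_uIoc_neg (fun y => ENNReal.ofReal (Real.exp (-potential a b y)) *
    tailIntegral a b s f y) θ (-x)
  rw [neg_neg] at hint
  rw [opII, opII, ← hint]
  simp only [potential_reflect, htail, abs_neg]

theorem lambdaZero_reflect (a b : ℝ → ℝ) (s : Side) (θ : ℝ) :
    lambdaZero (reflectA a) (reflectB b) s.flip (-θ) = lambdaZero a b s θ := by
  refine le_antisymm (lambdaZero_reflect_le a b s θ) ?_
  simpa [reflectA_reflectA, reflectB_reflectB, Side.flip_flip] using
    lambdaZero_reflect_le (reflectA a) (reflectB b) s.flip (-θ)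

theorem hardyDelta_reflect (a b : ℝ → ℝ) (s : Side) (θ : ℝ) :
    hardyDelta (reflectA a) (reflectB b) s.flip (-θ) = hardyDelta a b s θ := by
  refine le_antisymm ?_ (hardyDelta_le_reflect a b s θ)
  simpa [reflectA_reflectA, reflectB_reflectB, Side.flip_flip] using
    hardyDelta_le_reflect (reflectA a) (reflectB b) s.flip (-θ)

theorem varI_reflect (a b : ℝ → ℝ) (s : Side) (θ : ℝ) :
    varI (reflectA a) (reflectB b) s.flip (-θ) = varI a b s θ := by
  refine le_antisymm ?_ (varI_le_reflect a b s θ)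
  simpa [reflectA_reflectA, reflectB_reflectB, Side.flip_flip] using
    varI_le_reflect (reflectA a) (reflectB b) s.flip (-θ)

theorem varII_reflect (a b : ℝ → ℝ) (s : Side) (θ : ℝ) :
    varII (reflectA a) (reflectB b) s.flip (-θ) = varII a b s θ := by
  refine le_antisymm ?_ (varII_le_reflect a b s θ)
  simpa [reflectA_reflectA, reflectB_reflectB, Side.flip_flip] using
    varII_le_reflect (reflectA a) (reflectB b) s.flip (-θ)

end Reflection

section Limits

variable {a b : ℝ → ℝ}

theorem lambdaZero_minus_eq (a b : ℝ → ℝ) (θ : ℝ) :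
    lambdaZero a b .minus θ = lambdaZero (reflectA a) (reflectB b) .plus (-θ) :=
  (lambdaZero_reflect a b .minus θ).symm

theorem lambdaZero_plus_eq (a b : ℝ → ℝ) (θ : ℝ) :
    lambdaZero a b .plus θ = lambdaZero (reflectA a) (reflectB b) .minus (-θ) :=
  (lambdaZero_reflect a b .plus θ).symm

theorem continuous_lambdaZero (h : Admissible a b) (s : Side) : Continuous (lambdaZero a b s) := by
  cases s
  · exact continuous_lambdaZero_plus h
  · rw [funext (lambdaZero_minus_eq a b)]
    exact (continuous_lambdaZero_plus h.reflect).comp continuous_neg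

theorem antitone_lambdaZero_minus (h : Admissible a b) : Antitone (lambdaZero a b .minus) := by
  intro x y hxy
  rw [lambdaZero_minus_eq, lambdaZero_minus_eq]
  exact monotone_lambdaZero_plus h.reflect (neg_le_neg hxy)

theorem lambdaZero_le_inv_hardyDelta (h : Admissible a b) (s : Side) (θ : ℝ) :
    lambdaZero a b s θ ≤ (hardyDelta a b s θ)⁻¹ := by
  cases s
  · exact lambdaZero_le_inv_hardyDelta_plus h θ
  · rw [← lambdaZero_reflect, ← hardyDelta_reflect]
    exact lambdaZero_le_inv_hardyDelta_plus h.reflect (-θ)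

theorem varII_le_lambdaZero (h : Admissible a b) (s : Side) (θ : ℝ) :
    varII a b s θ ≤ lambdaZero a b s θ := by
  cases s
  · exact varII_le_lambdaZero_plus h θ
  · rw [← lambdaZero_reflect, ← varII_reflect]
    exact varII_le_lambdaZero_plus h.reflect (-θ)

theorem varI_le_varII (a b : ℝ → ℝ) (s : Side) (θ : ℝ) : varI a b s θ ≤ varII a b s θ := by
  cases s
  · exact varI_le_varII_plus a b θ
  · rw [← varI_reflect, ← varII_reflect]
    exact varI_le_varII_plus _ _ (-θ)

theorem lambdaZero_le_varI (h : Admissible a b) (s : Side) (θ : ℝ) :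
    lambdaZero a b s θ ≤ varI a b s θ := by
  cases s
  · exact lambdaZero_le_varI_plus h θ
  · rw [← lambdaZero_reflect, ← varI_reflect]
    exact lambdaZero_le_varI_plus h.reflect (-θ)

theorem inv_four_mul_hardyDelta_le_lambdaZero (h : Admissible a b) (s : Side) (θ : ℝ) :
    (4 * hardyDelta a b s θ)⁻¹ ≤ lambdaZero a b s θ := by
  refine le_trans ?_ ((varI_le_varII a b s θ).trans (varII_le_lambdaZero h s θ))
  cases s
  · exact inv_four_mul_hardyDelta_le_varI_plus h θ
  · rw [← hardyDelta_reflect, ← varI_reflect]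
    exact inv_four_mul_hardyDelta_le_varI_plus h.reflect (-θ)

/-- If the scale function is bounded at `∞`, then `λ₀⁺(θ) → ∞` as `θ → ∞`. -/
theorem tendsto_lambdaZero_plus_atTop_of_scale_ne_top (h : Admissible a b)
    (hs : ∫⁻ y in Ioi 0, scale a b y ≠ ⊤) :
    Tendsto (lambdaZero a b .plus) atTop (𝓝 ⊤) := by
  obtain ⟨V, -, hV0, -, hV⟩ := exists_hasDerivAt_speed_tail h
  have hle : ∀ᶠ θ in atTop, (4 * ((∫⁻ y in Ioi 0, scale a b y) * ENNReal.ofReal (V θ)))⁻¹ ≤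
      lambdaZero a b .plus θ := by
    filter_upwards [eventually_ge_atTop 0] with θ hθ
    refine le_trans ?_ (inv_four_mul_hardyDelta_le_lambdaZero h .plus θ)
    rw [ENNReal.inv_le_inv, hardyDelta_plus]
    gcongr
    refine iSup₂_le fun x hx => ?_
    rw [hV]
    exact mul_le_mul' (lintegral_mono_set fun y hy => hθ.trans_lt hy.1)
      (lintegral_mono_set (Ioi_subset_Ioi (le_of_lt hx)))
  have hlim : Tendsto (fun θ => (4 * ((∫⁻ y in Ioi 0, scale a b y) * ENNReal.ofReal (V θ)))⁻¹)
      atTop (𝓝 ⊤) := by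
    have h1 := ENNReal.tendsto_ofReal hV0
    rw [ENNReal.ofReal_zero] at h1
    have h2 := ENNReal.Tendsto.const_mul (a := 4)
      (ENNReal.Tendsto.const_mul h1 (Or.inr hs)) (Or.inr (by simp))
    simp only [mul_zero] at h2
    rw [← ENNReal.inv_zero]
    exact h2.inv
  exact tendsto_of_tendsto_of_tendsto_of_le_of_le' hlim tendsto_const_nhds hle
    (.of_forall fun _ => le_top)

/-- If the scale function is unbounded at `∞`, then `λ₀⁻(θ) → 0` as `θ → ∞`. -/
theorem tendsto_lambdaZero_minus_atTop_of_scale_eq_top (h : Admissible a b)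
    (hs : ∫⁻ y in Ioi 0, scale a b y = ⊤) :
    Tendsto (lambdaZero a b .minus) atTop (𝓝 0) := by
  set v := ∫⁻ y in Iio 0, speed a b y with hv
  have hv0 : v ≠ 0 := by
    intro h0
    have hae := (lintegral_eq_zero_iff h.measurable_speed).1 h0
    have hfalse : ∀ᵐ y ∂(volume.restrict (Iio (0 : ℝ))), False := by
      filter_upwards [hae] with y hy using h.speed_ne_zero y hy
    rw [ae_iff] at hfalse
    simp at hfalse
  have hle : ∀ᶠ θ : ℝ in atTop, lambdaZero a b .minus θ ≤
      ((∫⁻ y in Iic θ, scale a b y ∂(volume.restrict (Ioi 0))) * v)⁻¹ := by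
    filter_upwards [eventually_gt_atTop 0] with θ hθ
    refine (lambdaZero_le_inv_hardyDelta h .minus θ).trans ?_
    rw [ENNReal.inv_le_inv]
    refine le_trans (le_of_eq ?_) (le_iSup₂ (f := fun x (_ : x ∈ ray .minus θ) =>
      (∫⁻ y in uIoc θ x, ENNReal.ofReal (Real.exp (-potential a b y))) *
        ∫⁻ y in ray .minus x, ENNReal.ofReal (speedDensity a b y)) 0 hθ)
    rw [uIoc_of_ge hθ.le, Measure.restrict_restrict measurableSet_Iic, inter_comm, Ioi_inter_Iic]
    rfl
  have hlim : Tendsto (fun θ : ℝ =>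
      ((∫⁻ y in Iic θ, scale a b y ∂(volume.restrict (Ioi 0))) * v)⁻¹) atTop (𝓝 0) := by
    have h1 := (aecover_Iic (μ := volume.restrict (Ioi (0 : ℝ)))
      (tendsto_id (α := ℝ))).lintegral_tendsto_of_countably_generated
      h.measurable_scale.aemeasurable
    rw [hs] at h1
    have h2 := ENNReal.Tendsto.mul_const (b := v) h1 (Or.inl ENNReal.top_ne_zero)
    rw [ENNReal.top_mul hv0] at h2
    rw [← ENNReal.inv_top]
    exact h2.inv
  exact tendsto_of_tendsto_of_tendsto_of_le_of_le' tendsto_const_nhds hlim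
    (.of_forall fun _ => zero_le) hle

theorem lim_lambdaZero_minus_le_plus_atTop (h : Admissible a b) {P Q : ℝ≥0∞}
    (hP : Tendsto (lambdaZero a b .plus) atTop (𝓝 P))
    (hQ : Tendsto (lambdaZero a b .minus) atTop (𝓝 Q)) : Q ≤ P := by
  by_cases hs : ∫⁻ y in Ioi 0, scale a b y = ⊤
  · rw [tendsto_nhds_unique hQ (tendsto_lambdaZero_minus_atTop_of_scale_eq_top h hs)]
    exact zero_le
  · rw [tendsto_nhds_unique hP (tendsto_lambdaZero_plus_atTop_of_scale_ne_top h hs)]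
    exact le_top

theorem lim_lambdaZero_plus_le_minus_atBot (h : Admissible a b) {P Q : ℝ≥0∞}
    (hP : Tendsto (lambdaZero a b .plus) atBot (𝓝 P))
    (hQ : Tendsto (lambdaZero a b .minus) atBot (𝓝 Q)) : P ≤ Q := by
  refine lim_lambdaZero_minus_le_plus_atTop h.reflect ?_ ?_
  · refine (hQ.comp tendsto_neg_atTop_atBot).congr fun θ => ?_
    simp [lambdaZero_minus_eq]
  · refine (hP.comp tendsto_neg_atTop_atBot).congr fun θ => ?_
    simp [lambdaZero_plus_eq]

theorem tendsto_lambdaZero_atTop (h : Admissible a b) (s : Side) :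
    Tendsto (lambdaZero a b s) atTop (𝓝 (lambdaZeroExt a b s ⊤)) := by
  obtain ⟨l, hl⟩ : ∃ l, Tendsto (lambdaZero a b s) atTop (𝓝 l) := by
    cases s
    · exact ⟨_, tendsto_atTop_iSup (monotone_lambdaZero_plus h)⟩
    · exact ⟨_, tendsto_atTop_iInf (antitone_lambdaZero_minus h)⟩
  have : lambdaZeroExt a b s ⊤ = l := by rw [lambdaZeroExt, if_pos rfl, hl.liminf_eq]
  rwa [this]

theorem tendsto_lambdaZero_atBot (h : Admissible a b) (s : Side) :
    Tendsto (lambdaZero a b s) atBot (𝓝 (lambdaZeroExt a b s ⊥)) := by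
  obtain ⟨l, hl⟩ : ∃ l, Tendsto (lambdaZero a b s) atBot (𝓝 l) := by
    cases s
    · exact ⟨_, tendsto_atBot_iInf (monotone_lambdaZero_plus h)⟩
    · exact ⟨_, tendsto_atBot_iSup (antitone_lambdaZero_minus h)⟩
  have : lambdaZeroExt a b s ⊥ = l := by
    rw [lambdaZeroExt, if_neg bot_ne_top, if_pos rfl, hl.liminf_eq]
  rwa [this]

theorem lambdaZeroExt_coe (a b : ℝ → ℝ) (s : Side) (θ : ℝ) :
    lambdaZeroExt a b s θ = lambdaZero a b s θ := by
  simp [lambdaZeroExt]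

theorem exists_lambdaZeroExt_eq (h : Admissible a b) :
    ∃ θ : EReal, lambdaZeroExt a b .plus θ = lambdaZeroExt a b .minus θ := by
  by_cases h1 : ∀ θ, lambdaZero a b .plus θ < lambdaZero a b .minus θ
  · have hP := tendsto_lambdaZero_atTop h .plus
    have hQ := tendsto_lambdaZero_atTop h .minus
    exact ⟨⊤, le_antisymm (le_of_tendsto_of_tendsto' hP hQ fun θ => (h1 θ).le)
      (lim_lambdaZero_minus_le_plus_atTop h hP hQ)⟩
  by_cases h2 : ∀ θ, lambdaZero a b .minus θ < lambdaZero a b .plus θ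
  · have hP := tendsto_lambdaZero_atBot h .plus
    have hQ := tendsto_lambdaZero_atBot h .minus
    exact ⟨⊥, le_antisymm (lim_lambdaZero_plus_le_minus_atBot h hP hQ)
      (le_of_tendsto_of_tendsto' hQ hP fun θ => (h2 θ).le)⟩
  push Not at h1 h2
  obtain ⟨x, hx⟩ := h1
  obtain ⟨y, hy⟩ := h2
  obtain ⟨θ, hθ⟩ := intermediate_value_univ₂ (continuous_lambdaZero h .plus)
    (continuous_lambdaZero h .minus) hy hx
  exact ⟨θ, by rw [lambdaZeroExt_coe, lambdaZeroExt_coe, hθ]⟩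

theorem lambdaOne_eq_of_tendsto (h : Admissible a b) {l : Filter ℝ} [l.NeBot] {P : ℝ≥0∞}
    (hP : Tendsto (lambdaZero a b .plus) l (𝓝 P)) (hQ : Tendsto (lambdaZero a b .minus) l (𝓝 P)) :
    lambdaOne a b = P := by
  have hmax := hP.sup_nhds hQ
  have hmin := hP.inf_nhds hQ
  rw [sup_idem] at hmax
  rw [inf_idem] at hmin
  exact le_antisymm (ge_of_tendsto' hmax fun θ => lambdaOne_le_sup_lambdaZero h θ)
    (le_of_tendsto' hmin fun θ => inf_lambdaZero_le_lambdaOne h θ)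

theorem lambdaOne_eq_lambdaZeroExt (h : Admissible a b) {θ : EReal}
    (hθ : lambdaZeroExt a b .plus θ = lambdaZeroExt a b .minus θ) :
    lambdaOne a b = lambdaZeroExt a b .plus θ := by
  induction θ with
  | bot =>
    exact lambdaOne_eq_of_tendsto h (tendsto_lambdaZero_atBot h .plus)
      (hθ ▸ tendsto_lambdaZero_atBot h .minus)
  | top =>
    exact lambdaOne_eq_of_tendsto h (tendsto_lambdaZero_atTop h .plus)
      (hθ ▸ tendsto_lambdaZero_atTop h .minus)
  | coe x =>
    rw [lambdaZeroExt_coe, lambdaZeroExt_coe] at hθ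
    rw [lambdaZeroExt_coe]
    refine lambdaOne_eq_of_tendsto h (l := 𝓝 x) ((continuous_lambdaZero h .plus).tendsto x) ?_
    rw [hθ]
    exact (continuous_lambdaZero h .minus).tendsto x

end Limits

end OneDimDiffusion

theorem theorem4p4 (a b : ℝ → ℝ) (hab : OneDimDiffusion.Admissible a b) :
    -- comparison of the spectral gap with the half-line eigenvalues
    (OneDimDiffusion.lambdaOne a b ≤
        ⨅ θ : ℝ, OneDimDiffusion.lambdaZero a b .plus θ ⊔ OneDimDiffusion.lambdaZero a b .minus θ) ∧
    ((⨆ θ : ℝ, OneDimDiffusion.lambdaZero a b .plus θ ⊓ OneDimDiffusion.lambdaZero a b .minus θ) ≤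
        OneDimDiffusion.lambdaOne a b) ∧
    -- the limits at infinity exist, the two extended functions meet somewhere in `[-∞, ∞]`,
    -- and the spectral gap is their common value at any such point
    (∀ s : OneDimDiffusion.Side,
      Tendsto (OneDimDiffusion.lambdaZero a b s) atTop
        (𝓝 (OneDimDiffusion.lambdaZeroExt a b s ⊤)) ∧
      Tendsto (OneDimDiffusion.lambdaZero a b s) atBot
        (𝓝 (OneDimDiffusion.lambdaZeroExt a b s ⊥))) ∧
    (∃ θ : EReal, OneDimDiffusion.lambdaZeroExt a b .plus θ =
        OneDimDiffusion.lambdaZeroExt a b .minus θ) ∧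
    (∀ θ : EReal, OneDimDiffusion.lambdaZeroExt a b .plus θ =
        OneDimDiffusion.lambdaZeroExt a b .minus θ →
      OneDimDiffusion.lambdaOne a b = OneDimDiffusion.lambdaZeroExt a b .plus θ) ∧
    -- the median
    (∀ m : ℝ, OneDimDiffusion.IsMedian (OneDimDiffusion.invMeasure a b) m →
      OneDimDiffusion.lambdaOne a b ≤
        2 * (OneDimDiffusion.lambdaZero a b .plus m ⊓ OneDimDiffusion.lambdaZero a b .minus m) ∧
      OneDimDiffusion.lambdaZero a b .plus m ⊓ OneDimDiffusion.lambdaZero a b .minus m ≤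
        OneDimDiffusion.lambdaOne a b) ∧
    -- variational lower bounds, with equality for continuous coefficients
    (∀ (s : OneDimDiffusion.Side) (θ : ℝ),
      OneDimDiffusion.varII a b s θ ≤ OneDimDiffusion.lambdaZero a b s θ ∧
      OneDimDiffusion.varI a b s θ ≤ OneDimDiffusion.varII a b s θ ∧
      (Continuous b →
        OneDimDiffusion.lambdaZero a b s θ = OneDimDiffusion.varII a b s θ ∧
        OneDimDiffusion.varII a b s θ = OneDimDiffusion.varI a b s θ)) ∧
    -- Hardy-type bounds
    (∀ (s : OneDimDiffusion.Side) (θ : ℝ),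
      OneDimDiffusion.lambdaZero a b s θ ≤ (OneDimDiffusion.hardyDelta a b s θ)⁻¹ ∧
      (4 * OneDimDiffusion.hardyDelta a b s θ)⁻¹ ≤ OneDimDiffusion.lambdaZero a b s θ) := by
  refine ⟨le_iInf fun θ => OneDimDiffusion.lambdaOne_le_sup_lambdaZero hab θ,
    iSup_le fun θ => OneDimDiffusion.inf_lambdaZero_le_lambdaOne hab θ,
    fun s => ⟨OneDimDiffusion.tendsto_lambdaZero_atTop hab s,
      OneDimDiffusion.tendsto_lambdaZero_atBot hab s⟩,
    OneDimDiffusion.exists_lambdaZeroExt_eq hab,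
    fun θ hθ => OneDimDiffusion.lambdaOne_eq_lambdaZeroExt hab hθ,
    fun m hm => ⟨?_, OneDimDiffusion.inf_lambdaZero_le_lambdaOne hab m⟩,
    fun s θ => ⟨OneDimDiffusion.varII_le_lambdaZero hab s θ,
      OneDimDiffusion.varI_le_varII a b s θ, fun _ => ⟨?_, ?_⟩⟩,
    fun s θ => ⟨OneDimDiffusion.lambdaZero_le_inv_hardyDelta hab s θ,
      OneDimDiffusion.inv_four_mul_hardyDelta_le_lambdaZero hab s θ⟩⟩
  · have := hab.isProbabilityMeasure
    have hside : ∀ s, OneDimDiffusion.lambdaOne a b ≤ 2 * OneDimDiffusion.lambdaZero a b s m :=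
      fun s => OneDimDiffusion.lambdaOne_le_two_mul_lambdaZero hab (hm.measure_ray_le s)
    rcases min_choice (OneDimDiffusion.lambdaZero a b .plus m)
      (OneDimDiffusion.lambdaZero a b .minus m) with hmin | hmin <;> rw [hmin] <;> exact hside _
  · exact le_antisymm ((OneDimDiffusion.lambdaZero_le_varI hab s θ).trans
      (OneDimDiffusion.varI_le_varII a b s θ)) (OneDimDiffusion.varII_le_lambdaZero hab s θ)
  · exact le_antisymm ((OneDimDiffusion.varII_le_lambdaZero hab s θ).trans
      (OneDimDiffusion.lambdaZero_le_varI hab s θ)) (OneDimDiffusion.varI_le_varII a b s θ)
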